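/- Setting. Fix $p\ge 1$. For every $n\ge N_0$ (with some $N_0\ge 3$) let $\theta^*=(\alpha_1^*,\dots,\alpha_n^*,\beta_1^*,\dots,\beta_{n-1}^*)\in\mathbb R^{2n-1}$ and $\gamma^*\in\mathbb R^p$ (both may depend on $n$), put $\beta_n=0$, and let $Z_{ij}\in K^p$ ($1\le i\ne j\le n$) be covariate vectors, where $K\subset\mathbb R$ is a compact set not depending on $n$. Write $\pi_{ij}(\theta,\gamma)=\alpha_i+\beta_j+Z_{ij}^\top\gamma$ and $\lambda_{ij}=e^{\pi_{ij}}$. In the network Poisson model the edge weights $a_{ij}$, $i\neq j$, are independent and $a_{ij}$ is Poisson with mean $\lambda_{ij}(\theta^*,\gamma^*)$. Let $$F_i=\sum_{j\ne i}(\lambda_{ij}-a_{ij})\ (1\le i\le n),\qquad F_{n+j}=\sum_{i\neq j}(\lambda_{ij}-a_{ij})\ (1\le j\le n-1),\qquad Q=\sum_{i\ne j}Z_{ij}(\lambda_{ij}-a_{ij}).$$ A maximum likelihood estimate (MLE) is a solution $(\hat\theta,\hat\gamma)$ of the score equations $F(\theta,\gamma)=0$, $Q(\theta,\gamma)=0$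 (equivalently, a maximizer of the likelihood). Let $$H(\theta,\gamma)=\frac{\partial Q}{\partial\gamma^\top}-\frac{\partial Q}{\partial\theta^\top}\Big[\frac{\partial F}{\partial\theta^\top}\Big]^{-1}\frac{\partial F}{\partial\gamma^\top}.$$ Let $\epsilon_{n1},\epsilon_{n2}>0$, $q_n=\max_{i\ne j}\|Z_{ij}\|_\infty$ and $$\rho_n=\max_{i\ne j}|\alpha_i^*+\beta_j^*|+2\epsilon_{n1}+pq_n\|\gamma^*\|_\infty+pq_n\epsilon_{n2}.$$ Assume that for every $n\ge N_0$ and every $\theta$ with $\|\theta-\theta^*\|_\infty\le\epsilon_{n1}$ the matrix $H(\theta,\gamma^*)$ is positive definite and $\|H(\theta,\gamma^*)^{-1}\|_\infty\le\kappa_n/n^2$, where $\|\cdot\|_\infty$ of a matrix is the norm induced by the $\ell_\infty$ vector norm. Theorem. If $\kappa_n^2e^{40\rho_n}=o(n/\log n)$, then: 1. there is a constant $C$ such that for all $n\ge N_0$ the MLE exists with probability at least $1-C/n$; 2. for every $n\ge N_0$ and every weight matrix, there is at most one MLE $(\hat\theta,\hat\gamma)$; 3. as $n\to\infty$, $$\|\hat\gamma-\gamma^*\|_\infty=O_p\Big(\frac{\kappa_ne^{21\rho_n}\log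 n}{n}\Big)=o_p(1),\qquad \|\hat\theta-\theta^*\|_\infty=O_p\Big(e^{7\rho_n}\sqrt{\frac{\log n}{n}}\Big)=o_p(1),$$ where $(\hat\theta,\hat\gamma)$ is any choice that equals the MLE whenever the MLE exists. -/

import Mathlib

open Filter Asymptotics MeasureTheory ProbabilityTheory

namespace PoissonNetwork

noncomputable section

/-- Ordered pairs of distinct nodes: the possible directed edges `i → j`. -/
abbrev Edge (n : ℕ) : Type := {e : Fin n × Fin n // e.1 ≠ e.2}

/-- Index set of the degree parameter `θ = (α_1, …, α_n, β_1, …, β_{n-1})`. -/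
abbrev DegIdx (n : ℕ) : Type := Fin n ⊕ Fin (n - 1)

/-- The `j`-th node, for `j = 1, …, n - 1`, as one of the `n` nodes. -/
def node {n : ℕ} (j : Fin (n - 1)) : Fin n := Fin.castLE (Nat.sub_le n 1) j

/-- The out-degree parameters `α_1, …, α_n`. -/
def alpha {n : ℕ} (θ : DegIdx n → ℝ) (i : Fin n) : ℝ := θ (Sum.inl i)

/-- The in-degree parameters `β_1, …, β_n`, with the identification condition `β_n = 0`. -/
def beta {n : ℕ} (θ : DegIdx n → ℝ) (j : Fin n) : ℝ :=
  if h : (j : ℕ) < n - 1 then θ (Sum.inr ⟨j, h⟩) else 0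

variable {n p : ℕ}

/-- The linear predictor `π_{ij} = α_i + β_j + Z_{ij}ᵀ γ`. -/
def linPred (Z : Fin n → Fin n → Fin p → ℝ) (θ : DegIdx n → ℝ) (γ : Fin p → ℝ)
    (i j : Fin n) : ℝ :=
  alpha θ i + beta θ j + ∑ k, Z i j k * γ k

/-- The edge intensity `λ_{ij}(θ, γ) = exp π_{ij}`. -/
def lam (Z : Fin n → Fin n → Fin p → ℝ) (θ : DegIdx n → ℝ) (γ : Fin p → ℝ)
    (i j : Fin n) : ℝ :=
  Real.exp (linPred Z θ γ i j)

/-- The network Poisson model with parameters `(θ, γ)`: the weights `a_{ij}`, `i ≠ j`, are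
independent, and `a_{ij}` is Poisson distributed with mean `λ_{ij}(θ, γ)`.  (There are no
self-loops; the diagonal of the weight matrix is never used below.) -/
structure IsModel {Ω : Type*} [MeasurableSpace Ω] (P : Measure Ω)
    (a : Fin n → Fin n → Ω → ℕ) (Z : Fin n → Fin n → Fin p → ℝ)
    (θ : DegIdx n → ℝ) (γ : Fin p → ℝ) : Prop where
  measurable : ∀ i j, i ≠ j → Measurable (a i j)
  law : ∀ i j, i ≠ j → P.map (a i j) = poissonMeasure (lam Z θ γ i j).toNNReal
  indep : iIndepFun (fun e : Edge n => a e.1.1 e.1.2) P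

/-- The log-likelihood (with `μ = 0`, `β_n = 0`) of an observed weight matrix `A`. -/
def logLik (Z : Fin n → Fin n → Fin p → ℝ) (A : Fin n → Fin n → ℕ)
    (θ : DegIdx n → ℝ) (γ : Fin p → ℝ) : ℝ :=
  ∑ e : Edge n, ((A e.1.1 e.1.2 : ℝ) * linPred Z θ γ e.1.1 e.1.2
    - Real.exp (linPred Z θ γ e.1.1 e.1.2) - Real.log ((A e.1.1 e.1.2).factorial : ℝ))

/-- The functions `F = (F_1, …, F_{2n-1})` of the degree score equations:
`F_i = ∑_{j ≠ i} λ_{ij} - d_i` for `i ≤ n`, and `F_{n+j} = ∑_{i ≠ j} λ_{ij} - b_j` for `j < n`. -/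
def F (Z : Fin n → Fin n → Fin p → ℝ) (A : Fin n → Fin n → ℕ)
    (θ : DegIdx n → ℝ) (γ : Fin p → ℝ) : DegIdx n → ℝ
  | Sum.inl i => (∑ j with j ≠ i, lam Z θ γ i j) - ∑ j with j ≠ i, (A i j : ℝ)
  | Sum.inr j => (∑ i with i ≠ node j, lam Z θ γ i (node j))
      - ∑ i with i ≠ node j, (A i (node j) : ℝ)

/-- The functions `Q = ∑_{i ≠ j} Z_{ij} (λ_{ij} - a_{ij})` of the covariate score equations. -/
def Q (Z : Fin n → Fin n → Fin p → ℝ) (A : Fin n → Fin n → ℕ)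
    (θ : DegIdx n → ℝ) (γ : Fin p → ℝ) (k : Fin p) : ℝ :=
  ∑ e : Edge n, Z e.1.1 e.1.2 k * (lam Z θ γ e.1.1 e.1.2 - A e.1.1 e.1.2)

/-- `(θ, γ)` is a maximum likelihood estimate for the weight matrix `A`: it solves the score
equations.  (By concavity, it then maximizes the log-likelihood and conversely:
see `isMLE_iff_forall_logLik_le`.) -/
def IsMLE (Z : Fin n → Fin n → Fin p → ℝ) (A : Fin n → Fin n → ℕ)
    (θ : DegIdx n → ℝ) (γ : Fin p → ℝ) : Prop :=
  F Z A θ γ = 0 ∧ Q Z A θ γ = 0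

theorem linPred_add_smul (Z : Fin n → Fin n → Fin p → ℝ) (θ v : DegIdx n → ℝ)
    (γ w : Fin p → ℝ) (t : ℝ) (i j : Fin n) :
    linPred Z (θ + t • v) (γ + t • w) i j = linPred Z θ γ i j + t * linPred Z v w i j := by
  have hb : beta (θ + t • v) j = beta θ j + t * beta v j := by
    unfold beta; split_ifs <;> simp
  have hs : ∑ k, Z i j k * (γ + t • w) k = ∑ k, Z i j k * γ k + t * ∑ k, Z i j k * w k := by
    rw [Finset.mul_sum, ← Finset.sum_add_distrib]
    refine Finset.sum_congr rfl fun k _ => ?_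
    simp; ring
  unfold linPred
  rw [hb, hs]
  simp [alpha]; ring

theorem hasDerivAt_lam (Z : Fin n → Fin n → Fin p → ℝ) (θ v : DegIdx n → ℝ)
    (γ w : Fin p → ℝ) (i j : Fin n) :
    HasDerivAt (fun t : ℝ => lam Z (θ + t • v) (γ + t • w) i j)
      (lam Z θ γ i j * linPred Z v w i j) 0 := by
  have h1 : HasDerivAt (fun t : ℝ => linPred Z θ γ i j + t * linPred Z v w i j)
      (linPred Z v w i j) 0 := by
    simpa using ((hasDerivAt_id (0 : ℝ)).mul_const (linPred Z v w i j)).const_add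
      (linPred Z θ γ i j)
  have h2 := h1.exp
  simp only [zero_mul, add_zero] at h2
  simpa only [lam, linPred_add_smul] using h2

theorem sum_mul_beta (g : Fin n → ℝ) (v : DegIdx n → ℝ) :
    ∑ j, g j * beta v j = ∑ j : Fin (n - 1), g (node j) * v (Sum.inr j) := by
  cases n with
  | zero => simp
  | succ m =>
    rw [Fin.sum_univ_castSucc]
    have h : beta v (Fin.last m) = 0 := by simp [beta]
    rw [h, mul_zero, add_zero]
    refine Finset.sum_congr rfl fun j _ => ?_
    have h1 : beta v j.castSucc = v (Sum.inr j) := by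
      have hj : (j : ℕ) < m := j.2
      simp [beta, hj]
    rw [h1]
    rfl

theorem sum_edge (f : Fin n → Fin n → ℝ) :
    ∑ e : Edge n, f e.1.1 e.1.2 = ∑ i, ∑ j with j ≠ i, f i j := by
  have h := Finset.sum_subtype (Finset.univ.filter fun e : Fin n × Fin n => e.1 ≠ e.2)
    (p := fun e : Fin n × Fin n => e.1 ≠ e.2) (F := inferInstance) (by simp) (fun e => f e.1 e.2)
  rw [← h, Finset.sum_filter, Fintype.sum_prod_type]
  refine Finset.sum_congr rfl fun i _ => ?_
  rw [Finset.sum_filter]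
  simp only [ne_comm]

theorem sum_edge' (f : Fin n → Fin n → ℝ) :
    ∑ e : Edge n, f e.1.1 e.1.2 = ∑ j, ∑ i with i ≠ j, f i j := by
  rw [sum_edge]
  simp only [Finset.sum_filter]
  rw [Finset.sum_comm]
  simp only [ne_comm]

/-- The weighted sum of the linear predictor over the edges, by coordinates of `(v, w)`. -/
theorem sum_mul_linPred (Z : Fin n → Fin n → Fin p → ℝ) (g : Fin n → Fin n → ℝ)
    (v : DegIdx n → ℝ) (w : Fin p → ℝ) :
    ∑ e : Edge n, g e.1.1 e.1.2 * linPred Z v w e.1.1 e.1.2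
      = ∑ i, (∑ j with j ≠ i, g i j) * v (Sum.inl i)
        + ∑ j : Fin (n - 1), (∑ i with i ≠ node j, g i (node j)) * v (Sum.inr j)
        + ∑ k, (∑ e : Edge n, Z e.1.1 e.1.2 k * g e.1.1 e.1.2) * w k := by
  have h1 : ∑ e : Edge n, g e.1.1 e.1.2 * alpha v e.1.1
      = ∑ i, (∑ j with j ≠ i, g i j) * v (Sum.inl i) := by
    rw [sum_edge (fun i j => g i j * alpha v i)]
    simp only [Finset.sum_mul, alpha]
  have h2 : ∑ e : Edge n, g e.1.1 e.1.2 * beta v e.1.2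
      = ∑ j : Fin (n - 1), (∑ i with i ≠ node j, g i (node j)) * v (Sum.inr j) := by
    rw [sum_edge' (fun i j => g i j * beta v j)]
    simp only [← Finset.sum_mul]
    exact sum_mul_beta (fun j => ∑ i with i ≠ j, g i j) v
  have h3 : ∑ e : Edge n, g e.1.1 e.1.2 * ∑ k, Z e.1.1 e.1.2 k * w k
      = ∑ k, (∑ e : Edge n, Z e.1.1 e.1.2 k * g e.1.1 e.1.2) * w k := by
    simp only [Finset.sum_mul, Finset.mul_sum]
    rw [Finset.sum_comm]
    refine Finset.sum_congr rfl fun k _ => Finset.sum_congr rfl fun e _ => by ring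
  rw [← h1, ← h2, ← h3, ← Finset.sum_add_distrib, ← Finset.sum_add_distrib]
  refine Finset.sum_congr rfl fun e _ => ?_
  unfold linPred; ring

/-- The score pairing: `F` and `Q` together are minus the gradient of the log-likelihood. -/
theorem score_pairing (Z : Fin n → Fin n → Fin p → ℝ) (A : Fin n → Fin n → ℕ)
    (θ v : DegIdx n → ℝ) (γ w : Fin p → ℝ) :
    ∑ e : Edge n, (lam Z θ γ e.1.1 e.1.2 - A e.1.1 e.1.2) * linPred Z v w e.1.1 e.1.2
      = ∑ s, F Z A θ γ s * v s + ∑ k, Q Z A θ γ k * w k := by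
  rw [sum_mul_linPred Z (fun i j => lam Z θ γ i j - A i j) v w, Fintype.sum_sum_type]
  simp only [F, Q, Finset.sum_sub_distrib]

/-- The solutions of the score equations are exactly the maximizers of the log-likelihood. -/
theorem isMLE_iff_forall_logLik_le (Z : Fin n → Fin n → Fin p → ℝ) (A : Fin n → Fin n → ℕ)
    (θ : DegIdx n → ℝ) (γ : Fin p → ℝ) :
    IsMLE Z A θ γ ↔ ∀ θ' γ', logLik Z A θ' γ' ≤ logLik Z A θ γ := by
  constructor
  · rintro ⟨hF, hQ⟩ θ' γ'
    have h := score_pairing Z A θ (θ' - θ) γ (γ' - γ)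
    rw [hF, hQ] at h
    simp only [Pi.zero_apply, zero_mul, Finset.sum_const_zero, add_zero] at h
    have hle : logLik Z A θ' γ' ≤ logLik Z A θ γ
        - ∑ e : Edge n, (lam Z θ γ e.1.1 e.1.2 - A e.1.1 e.1.2)
            * linPred Z (θ' - θ) (γ' - γ) e.1.1 e.1.2 := by
      unfold logLik
      rw [← Finset.sum_sub_distrib]
      refine Finset.sum_le_sum fun e _ => ?_
      have hl := linPred_add_smul Z θ (θ' - θ) γ (γ' - γ) 1 e.1.1 e.1.2
      simp only [one_smul, add_sub_cancel, one_mul] at hl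
      have hexp := Real.add_one_le_exp (linPred Z (θ' - θ) (γ' - γ) e.1.1 e.1.2)
      have hpos := Real.exp_pos (linPred Z θ γ e.1.1 e.1.2)
      have hmul := mul_le_mul_of_nonneg_left hexp hpos.le
      rw [← Real.exp_add, ← hl] at hmul
      unfold lam
      rw [hl] at hmul ⊢
      linarith
    rw [h, sub_zero] at hle
    exact hle
  · intro hmax
    have key : ∀ (v : DegIdx n → ℝ) (w : Fin p → ℝ),
        ∑ s, F Z A θ γ s * v s + ∑ k, Q Z A θ γ k * w k = 0 := by
      intro v w
      rw [← score_pairing]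
      have hd : HasDerivAt (fun t : ℝ => logLik Z A (θ + t • v) (γ + t • w))
          (∑ e : Edge n, ((A e.1.1 e.1.2 : ℝ) * linPred Z v w e.1.1 e.1.2
            - lam Z θ γ e.1.1 e.1.2 * linPred Z v w e.1.1 e.1.2)) 0 := by
        unfold logLik
        refine HasDerivAt.fun_sum fun e _ => ?_
        have h1 : HasDerivAt (fun t : ℝ => linPred Z (θ + t • v) (γ + t • w) e.1.1 e.1.2)
            (linPred Z v w e.1.1 e.1.2) 0 := by
          simp only [linPred_add_smul]
          simpa using ((hasDerivAt_id (0 : ℝ)).mul_const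
            (linPred Z v w e.1.1 e.1.2)).const_add (linPred Z θ γ e.1.1 e.1.2)
        exact ((h1.const_mul (A e.1.1 e.1.2 : ℝ)).sub
          (hasDerivAt_lam Z θ v γ w e.1.1 e.1.2)).sub_const _
      have hloc : IsLocalMax (fun t : ℝ => logLik Z A (θ + t • v) (γ + t • w)) 0 :=
        Filter.Eventually.of_forall fun t => by simpa using hmax (θ + t • v) (γ + t • w)
      have h0 := hloc.hasDerivAt_eq_zero hd
      rw [← neg_eq_zero, ← Finset.sum_neg_distrib, ← h0]
      refine Finset.sum_congr rfl fun e _ => by ring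
    constructor
    · funext s
      simpa [Pi.single_apply] using key (Pi.single s 1) 0
    · funext k
      simpa [Pi.single_apply] using key 0 (Pi.single k 1)

/-- The Jacobian matrix `∂F/∂θᵀ`. -/
def jacFθ (Z : Fin n → Fin n → Fin p → ℝ) (θ : DegIdx n → ℝ) (γ : Fin p → ℝ) :
    Matrix (DegIdx n) (DegIdx n) ℝ :=
  Matrix.fromBlocks
    (Matrix.diagonal fun i => ∑ j with j ≠ i, lam Z θ γ i j)
    (Matrix.of fun i j => if i ≠ node j then lam Z θ γ i (node j) else 0)
    (Matrix.of fun j i => if i ≠ node j then lam Z θ γ i (node j) else 0)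
    (Matrix.diagonal fun j => ∑ i with i ≠ node j, lam Z θ γ i (node j))

/-- The Jacobian matrix `∂F/∂γᵀ`. -/
def jacFγ (Z : Fin n → Fin n → Fin p → ℝ) (θ : DegIdx n → ℝ) (γ : Fin p → ℝ) :
    Matrix (DegIdx n) (Fin p) ℝ :=
  Matrix.of fun s k => match s with
    | Sum.inl i => ∑ j with j ≠ i, lam Z θ γ i j * Z i j k
    | Sum.inr j => ∑ i with i ≠ node j, lam Z θ γ i (node j) * Z i (node j) k

/-- The Jacobian matrix `∂Q/∂θᵀ`. -/
def jacQθ (Z : Fin n → Fin n → Fin p → ℝ) (θ : DegIdx n → ℝ) (γ : Fin p → ℝ) :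
    Matrix (Fin p) (DegIdx n) ℝ :=
  Matrix.of fun k s => match s with
    | Sum.inl i => ∑ j with j ≠ i, Z i j k * lam Z θ γ i j
    | Sum.inr j => ∑ i with i ≠ node j, Z i (node j) k * lam Z θ γ i (node j)

/-- The Jacobian matrix `∂Q/∂γᵀ`. -/
def jacQγ (Z : Fin n → Fin n → Fin p → ℝ) (θ : DegIdx n → ℝ) (γ : Fin p → ℝ) :
    Matrix (Fin p) (Fin p) ℝ :=
  Matrix.of fun k l => ∑ e : Edge n,
    Z e.1.1 e.1.2 k * (lam Z θ γ e.1.1 e.1.2 * Z e.1.1 e.1.2 l)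

/-- `jacFθ` and `jacFγ` are the Jacobian matrices of `F`: they give all its directional
derivatives, whatever the data. -/
theorem hasDerivAt_F (Z : Fin n → Fin n → Fin p → ℝ) (A : Fin n → Fin n → ℕ)
    (θ v : DegIdx n → ℝ) (γ w : Fin p → ℝ) (s : DegIdx n) :
    HasDerivAt (fun t : ℝ => F Z A (θ + t • v) (γ + t • w) s)
      ((jacFθ Z θ γ).mulVec v s + (jacFγ Z θ γ).mulVec w s) 0 := by
  cases s with
  | inl i =>
    have hd : HasDerivAt (fun t : ℝ => F Z A (θ + t • v) (γ + t • w) (Sum.inl i))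
        (∑ j with j ≠ i, lam Z θ γ i j * linPred Z v w i j) 0 := by
      unfold F
      exact (HasDerivAt.fun_sum fun j _ => hasDerivAt_lam Z θ v γ w i j).sub_const _
    convert hd using 1
    simp only [Matrix.mulVec, dotProduct, Fintype.sum_sum_type, jacFθ, jacFγ,
      Matrix.fromBlocks_apply₁₁, Matrix.fromBlocks_apply₁₂, Matrix.of_apply,
      Matrix.diagonal_apply]
    rw [← sum_mul_beta (fun j => if i ≠ j then lam Z θ γ i j else 0) v]
    simp only [ite_mul, zero_mul, Finset.sum_ite_eq, Finset.mem_univ, if_true, linPred, mul_add,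
      Finset.sum_add_distrib, Finset.sum_mul, Finset.mul_sum, alpha]
    congr 1
    · congr 1
      rw [Finset.sum_filter]
      simp only [ne_comm]
    · rw [Finset.sum_comm]
      simp only [mul_assoc]
  | inr j =>
    have hd : HasDerivAt (fun t : ℝ => F Z A (θ + t • v) (γ + t • w) (Sum.inr j))
        (∑ i with i ≠ node j, lam Z θ γ i (node j) * linPred Z v w i (node j)) 0 := by
      unfold F
      exact (HasDerivAt.fun_sum fun i _ => hasDerivAt_lam Z θ v γ w i (node j)).sub_const _
    convert hd using 1
    have hb : beta v (node j) = v (Sum.inr j) := by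
      have hj : (j : ℕ) < n - 1 := j.2
      simp [beta, node, hj]
    simp only [Matrix.mulVec, dotProduct, Fintype.sum_sum_type, jacFθ, jacFγ,
      Matrix.fromBlocks_apply₂₁, Matrix.fromBlocks_apply₂₂, Matrix.of_apply,
      Matrix.diagonal_apply]
    simp only [ite_mul, zero_mul, Finset.sum_ite_eq, Finset.mem_univ, if_true, linPred, mul_add,
      Finset.sum_add_distrib, Finset.sum_mul, Finset.mul_sum, alpha, hb]
    congr 1
    · congr 1
      rw [Finset.sum_filter]
    · rw [Finset.sum_comm]
      simp only [mul_assoc]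

/-- `jacQθ` and `jacQγ` are the Jacobian matrices of `Q`. -/
theorem hasDerivAt_Q (Z : Fin n → Fin n → Fin p → ℝ) (A : Fin n → Fin n → ℕ)
    (θ v : DegIdx n → ℝ) (γ w : Fin p → ℝ) (k : Fin p) :
    HasDerivAt (fun t : ℝ => Q Z A (θ + t • v) (γ + t • w) k)
      ((jacQθ Z θ γ).mulVec v k + (jacQγ Z θ γ).mulVec w k) 0 := by
  have hd : HasDerivAt (fun t : ℝ => Q Z A (θ + t • v) (γ + t • w) k)
      (∑ e : Edge n, Z e.1.1 e.1.2 k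
        * (lam Z θ γ e.1.1 e.1.2 * linPred Z v w e.1.1 e.1.2)) 0 := by
    unfold Q
    exact HasDerivAt.fun_sum fun e _ =>
      ((hasDerivAt_lam Z θ v γ w e.1.1 e.1.2).sub_const _).const_mul _
  convert hd using 1
  simp only [← mul_assoc]
  rw [sum_mul_linPred Z (fun i j => Z i j k * lam Z θ γ i j) v w]
  simp only [Matrix.mulVec, dotProduct, Fintype.sum_sum_type, jacQθ, jacQγ, Matrix.of_apply]
  congr 1
  refine Finset.sum_congr rfl fun l _ => ?_
  congr 1
  refine Finset.sum_congr rfl fun e _ => by ring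

/-- `H = ∂Q/∂γᵀ - ∂Q/∂θᵀ (∂F/∂θᵀ)⁻¹ ∂F/∂γᵀ`, the information matrix of the profiled
log-likelihood.  (`∂F/∂θᵀ` is invertible for `n ≥ 3`.) -/
def H (Z : Fin n → Fin n → Fin p → ℝ) (θ : DegIdx n → ℝ) (γ : Fin p → ℝ) :
    Matrix (Fin p) (Fin p) ℝ :=
  jacQγ Z θ γ - jacQθ Z θ γ * (jacFθ Z θ γ)⁻¹ * jacFγ Z θ γ

/-- `q = max_{i ≠ j} ‖Z_{ij}‖_∞`. -/
def covBound (Z : Fin n → Fin n → Fin p → ℝ) : ℝ := ⨆ e : Edge n, ‖Z e.1.1 e.1.2‖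

/-- `ρ = max_{i ≠ j} |α_i + β_j| + 2 ε₁ + p q ‖γ‖_∞ + p q ε₂`. -/
def rho (Z : Fin n → Fin n → Fin p → ℝ) (θ : DegIdx n → ℝ) (γ : Fin p → ℝ)
    (ε₁ ε₂ : ℝ) : ℝ :=
  (⨆ e : Edge n, |alpha θ e.1.1 + beta θ e.1.2|) + 2 * ε₁
    + p * covBound Z * ‖γ‖ + p * covBound Z * ε₂

section Norm

attribute [local instance] Matrix.linftyOpNormedAddCommGroup

/-- The matrix norm induced by the `ℓ_∞` vector norm (maximal absolute row sum). -/
def matNorm (M : Matrix (Fin p) (Fin p) ℝ) : ℝ := ‖M‖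

end Norm

/-- `X_n = O_p(r_n)`, where `X_n` is a random variable on the `n`-th probability space. -/
def IsBigOp {Ω : ℕ → Type*} [∀ n, MeasurableSpace (Ω n)] (P : ∀ n, Measure (Ω n))
    (X : ∀ n, Ω n → ℝ) (r : ℕ → ℝ) : Prop :=
  ∀ ε > 0, ∃ M : ℝ, ∀ᶠ n in atTop, (P n).real {ω | M * r n < |X n ω|} ≤ ε

/-- `X_n = o_p(1)`: convergence to zero in probability. -/
def IsLittleOpOne {Ω : ℕ → Type*} [∀ n, MeasurableSpace (Ω n)] (P : ∀ n, Measure (Ω n))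
    (X : ∀ n, Ω n → ℝ) : Prop :=
  ∀ δ > 0, Tendsto (fun n => (P n).real {ω | δ < |X n ω|}) atTop (nhds 0)

end

end PoissonNetwork

open PoissonNetwork

/-!
Write `λ*` for the intensities at the true parameter `x* = (θ*, γ*)`, `E = exp ρ`, so that
`E⁻¹ ≤ λ* ≤ E`, and `τ = √(log n / n)`. The score equations say that the edge function `λ(x) - a`
is orthogonal to all linear predictors (`isMLE_iff_scorePairing`). Let `S` be the solution map of
least squares on the edges with weights `λ*`. Then `x` is an MLE if and only if
`S (λ(x) - a) = 0`, and the derivative of this map at `x*` is the identity.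

*Stability of `S` in sup norm.* For the degree part this is a maximum principle for two-way
additive models (`abs_add_le_of_row_col_sums`): the error is at most of order `E⁵` times the mean
row and column errors. For the covariate part, each covariate is corrected by a degree direction so
that the result is orthogonal to all degree directions (`Bounds.exists_efficient_basis`). The
information of the corrected covariates is `H`, so only the pairing of the data with these
directions, multiplied by `H⁻¹`, enters the covariate part (`Bounds.norm_covariate_le`).

*Size of the noise.* A Chernoff bound for the centred Poisson weights, applied to the `2n` row and
column sums and the `p` corrected covariate scores, shows that `‖S (a - λ*)‖` has order `E⁶ τ`, with
covariate part of order `κ E⁷ τ²`, outside of an event of probability `O(1 / n)`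
(`Bounds.measureReal_not_noiseBounds_le`). Treating the corrected score as one linear statistic is
what gives its covariate part the order `τ²`.

*Existence and location.* On a ball of radius `r` of order `E⁶ τ` about `x*`, the remainder of the
linearization is a contraction up to `κ E¹³ r`, of order `κ E¹⁹ τ`, which is small by the rate
condition. Hence `x ↦ S (λ(x) - a)` has a zero in this ball, and the quadratic size of the
remainder improves the bound on the covariate part to `κ E¹⁹ τ²` (`Bounds.exists_mle_near`).

*Uniqueness.* Positive definiteness of `H` makes the linear predictor injective
(`predictor_injective`), and `exp` is strictly increasing, so two MLEs coincide (`mle_unique`). The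
MLE is therefore the zero found above, whichever choice of `(θ̂, γ̂)` is made.

The rate condition says that `κ E²⁰ τ` tends to `0`; that `E¹⁹ τ` does too follows from the lower
bound `1 ≤ κ E q²`, where `q` bounds the covariates (`Bounds.one_le_kappa`).
-/

namespace PoissonNetwork

/-! ### Linear predictor and score -/

/-- The full parameter space, of pairs `(θ, γ)`. -/
abbrev Param (n p : ℕ) : Type := (DegIdx n → ℝ) × (Fin p → ℝ)

/-- The linear predictor as a linear map from parameters to functions of the pair `(i, j)`. -/
noncomputable def predictor {n p : ℕ} (Z : Fin n → Fin n → Fin p → ℝ) :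
    Param n p →ₗ[ℝ] (Fin n → Fin n → ℝ) where
  toFun x i j := linPred Z x.1 x.2 i j
  map_add' x y := by
    funext i j
    simpa using linPred_add_smul Z x.1 y.1 x.2 y.2 1 i j
  map_smul' t x := by
    funext i j
    have h0 : linPred Z 0 0 i j = 0 := by simp [linPred, alpha, beta]
    simpa [h0] using linPred_add_smul Z 0 x.1 0 x.2 t i j

/-- The pairing `(g, y) ↦ ∑_{i ≠ j} g_{ij} π_{ij}(y)` of edge functions with parameter directions.
The score equations say that `λ - a` annihilates all directions. -/
noncomputable def scorePairing {n p : ℕ} (Z : Fin n → Fin n → Fin p → ℝ) :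
    (Fin n → Fin n → ℝ) →ₗ[ℝ] Param n p →ₗ[ℝ] ℝ :=
  LinearMap.mk₂ ℝ (fun g y => ∑ e : Edge n, g e.1.1 e.1.2 * predictor Z y e.1.1 e.1.2)
    (fun g g' y => by simp [add_mul, Finset.sum_add_distrib])
    (fun c g y => by simp [Finset.mul_sum, mul_assoc])
    (fun g y y' => by simp [mul_add, Finset.sum_add_distrib])
    (fun c g y => by simp [Finset.mul_sum, mul_left_comm])

section
variable {n p : ℕ} (Z : Fin n → Fin n → Fin p → ℝ)

theorem predictor_apply (x : Param n p) (i j : Fin n) :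
    predictor Z x i j = linPred Z x.1 x.2 i j := rfl

theorem scorePairing_apply (g : Fin n → Fin n → ℝ) (y : Param n p) :
    scorePairing Z g y = ∑ e : Edge n, g e.1.1 e.1.2 * predictor Z y e.1.1 e.1.2 := rfl

theorem lam_add (x y : Param n p) (i j : Fin n) :
    lam Z (x.1 + y.1) (x.2 + y.2) i j = lam Z x.1 x.2 i j * Real.exp (predictor Z y i j) := by
  have := linPred_add_smul Z x.1 y.1 x.2 y.2 1 i j
  simp only [one_smul, one_mul] at this
  rw [lam, this, Real.exp_add]
  rfl

theorem isMLE_iff_scorePairing (A : Fin n → Fin n → ℕ) (x : Param n p) :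
    IsMLE Z A x.1 x.2 ↔
      scorePairing Z (fun i j => lam Z x.1 x.2 i j - (A i j : ℝ)) = 0 := by
  constructor
  · rintro ⟨hF, hQ⟩
    refine LinearMap.ext fun y => ?_
    have h := score_pairing Z A x.1 y.1 x.2 y.2
    rw [hF, hQ] at h
    simpa [scorePairing_apply, predictor_apply] using h
  · intro h
    have key : ∀ (v : DegIdx n → ℝ) (w : Fin p → ℝ),
        ∑ s, F Z A x.1 x.2 s * v s + ∑ k, Q Z A x.1 x.2 k * w k = 0 := by
      intro v w
      rw [← score_pairing]
      exact LinearMap.congr_fun h (v, w)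
    constructor
    · funext s
      simpa [Pi.single_apply] using key (Pi.single s 1) 0
    · funext k
      simpa [Pi.single_apply] using key 0 (Pi.single k 1)

/-- The Jacobian of the score in the direction `x` is the functional represented by the edge
function `λ · π(x)`. -/
theorem jacobian_dotProduct (θ : DegIdx n → ℝ) (γ : Fin p → ℝ) (x y : Param n p) :
    ((jacFθ Z θ γ).mulVec x.1 + (jacFγ Z θ γ).mulVec x.2) ⬝ᵥ y.1
      + ((jacQθ Z θ γ).mulVec x.1 + (jacQγ Z θ γ).mulVec x.2) ⬝ᵥ y.2
      = scorePairing Z (lam Z θ γ * predictor Z x) y := by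
  have h1 : HasDerivAt (fun t : ℝ => ∑ s, F Z 0 (θ + t • x.1) (γ + t • x.2) s * y.1 s
      + ∑ k, Q Z 0 (θ + t • x.1) (γ + t • x.2) k * y.2 k)
      (((jacFθ Z θ γ).mulVec x.1 + (jacFγ Z θ γ).mulVec x.2) ⬝ᵥ y.1
      + ((jacQθ Z θ γ).mulVec x.1 + (jacQγ Z θ γ).mulVec x.2) ⬝ᵥ y.2) 0 :=
    (HasDerivAt.fun_sum fun s _ => (hasDerivAt_F Z 0 θ x.1 γ x.2 s).mul_const _).add
      (HasDerivAt.fun_sum fun k _ => (hasDerivAt_Q Z 0 θ x.1 γ x.2 k).mul_const _)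
  simp only [← score_pairing] at h1
  refine h1.unique ?_
  rw [scorePairing_apply]
  exact HasDerivAt.fun_sum fun e _ =>
    ((hasDerivAt_lam Z θ x.1 γ x.2 e.1.1 e.1.2).sub_const _).mul_const _

/-! ### Degree directions -/

/-- An edge function that annihilates all directions of the degree parameter has vanishing row
and column sums, the column of the node `n` with `β_n = 0` included. -/
theorem row_col_sum_eq_zero {g : Fin n → Fin n → ℝ}
    (hg : ∀ v : DegIdx n → ℝ, scorePairing Z g (v, 0) = 0) :
    (∀ i, ∑ j with j ≠ i, g i j = 0) ∧ ∀ j, ∑ i with i ≠ j, g i j = 0 := by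
  have key : ∀ v : DegIdx n → ℝ, ∑ i, (∑ j with j ≠ i, g i j) * v (Sum.inl i)
        + ∑ j : Fin (n - 1), (∑ i with i ≠ node j, g i (node j)) * v (Sum.inr j) = 0 := by
    intro v
    have h := sum_mul_linPred Z g v 0
    simp only [Pi.zero_apply, mul_zero, Finset.sum_const_zero, add_zero] at h
    rw [← h]
    exact hg v
  have hrow : ∀ i, ∑ j with j ≠ i, g i j = 0 := fun i => by
    simpa [Pi.single_apply] using key (Pi.single (Sum.inl i) 1)
  have hcol : ∀ j : Fin (n - 1), ∑ i with i ≠ node j, g i (node j) = 0 := fun j => by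
    simpa [Pi.single_apply] using key (Pi.single (Sum.inr j) 1)
  refine ⟨hrow, fun j => ?_⟩
  have hcol' : ∀ k : Fin n, (k : ℕ) < n - 1 → ∑ i with i ≠ k, g i k = 0 :=
    fun k hk => hcol ⟨k, hk⟩
  by_cases hj : (j : ℕ) < n - 1
  · exact hcol' j hj
  · -- the remaining column sum is the sum of all rows minus the sum of all other columns
    have h := (sum_edge g).symm.trans (sum_edge' g)
    rw [Finset.sum_eq_zero fun i _ => hrow i,
      Finset.sum_eq_single j (fun k _ hk => hcol' k (by
        have := k.2
        have := Fin.val_ne_of_ne hk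
        omega)) (by simp)] at h
    exact h.symm

theorem predictor_degree (v : DegIdx n → ℝ) (i j : Fin n) :
    predictor Z (v, 0) i j = alpha v i + beta v j := by
  simp [predictor_apply, linPred]

theorem predictor_eq_add (v : DegIdx n → ℝ) (w : Fin p → ℝ) (i j : Fin n) :
    predictor Z (v, w) i j = alpha v i + beta v j + ∑ k, Z i j k * w k := rfl

/-- The sup norm of the degree parameter is controlled by the sums `α_i + β_j`. -/
theorem norm_degree_le (hn : 0 < n) (v : DegIdx n → ℝ) {X : ℝ}
    (h : ∀ i j, |alpha v i + beta v j| ≤ X) : ‖v‖ ≤ 2 * X := by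
  let l : Fin n := ⟨n - 1, by omega⟩
  have hl : beta v l = 0 := by simp [beta, l]
  have hX : 0 ≤ X := (abs_nonneg _).trans (h l l)
  refine (pi_norm_le_iff_of_nonneg (by linarith)).2 fun s => ?_
  rw [Real.norm_eq_abs]
  cases s with
  | inl i =>
    have := h i l
    rw [hl, add_zero] at this
    change |alpha v i| ≤ _
    linarith
  | inr j =>
    have hb : v (Sum.inr j) = beta v (node j) := by simp [beta, node, j.2]
    have h1 := abs_le.1 (h l (node j))
    have h2 := abs_le.1 (h l l)
    rw [hl, add_zero] at h2
    rw [hb, abs_le]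
    constructor <;> linarith

theorem degree_eq_zero (hn : 3 ≤ n) (v : DegIdx n → ℝ)
    (h : ∀ i j, i ≠ j → alpha v i + beta v j = 0) : v = 0 := by
  let l : Fin n := ⟨n - 1, by omega⟩
  have hl : beta v l = 0 := by simp [beta, l]
  have ha : ∀ i, i ≠ l → alpha v i = 0 := fun i hi => by simpa [hl] using h i l hi
  have hb : ∀ j, beta v j = 0 := by
    intro j
    obtain ⟨i, hi⟩ : ∃ i : Fin n, i ≠ j ∧ i ≠ l := by
      have : ∃ i ∈ (Finset.univ : Finset (Fin n)), i ∉ ({j, l} : Finset (Fin n)) :=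
        Finset.exists_mem_notMem_of_card_lt_card (lt_of_le_of_lt Finset.card_le_two (by simpa))
      simpa using this
    simpa [ha i hi.2] using h i j hi.1
  have hal : ∀ i, alpha v i = 0 := by
    intro i
    obtain ⟨j, hj⟩ : ∃ j : Fin n, i ≠ j := by
      by_cases h0 : i = l
      · exact ⟨⟨0, by omega⟩, by rw [h0]; simp [l, Fin.ext_iff]; omega⟩
      · exact ⟨l, h0⟩
    simpa [hb] using h i j hj
  have := norm_degree_le (by omega) v (X := 0) (by simp [hb, hal])
  simpa using this

/-! ### Fisher information and weighted least squares -/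

theorem scorePairing_mul_comm (l : Fin n → Fin n → ℝ) (x y : Param n p) :
    scorePairing Z (l * predictor Z x) y = scorePairing Z (l * predictor Z y) x := by
  simp only [scorePairing_apply, Pi.mul_apply]
  exact Finset.sum_congr rfl fun e _ => by ring

theorem predictor_eq_zero_of_scorePairing {l : Fin n → Fin n → ℝ} (hl : ∀ i j, i ≠ j → 0 < l i j)
    {x : Param n p} (h : scorePairing Z (l * predictor Z x) x = 0) {i j : Fin n} (hij : i ≠ j) :
    predictor Z x i j = 0 := by
  rw [scorePairing_apply] at h
  have h0 : ∀ e : Edge n, 0 ≤ (l * predictor Z x) e.1.1 e.1.2 * predictor Z x e.1.1 e.1.2 := by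
    intro e
    have := mul_nonneg (hl _ _ e.2).le (mul_self_nonneg (predictor Z x e.1.1 e.1.2))
    simpa [mul_assoc] using this
  have h1 := (Finset.sum_eq_zero_iff_of_nonneg fun e _ => h0 e).1 h ⟨(i, j), hij⟩ (by simp)
  simp only [Pi.mul_apply] at h1
  have := (hl i j hij).ne'
  simpa [this] using h1

theorem isUnit_jacFθ (hn : 3 ≤ n) (θ : DegIdx n → ℝ) (γ : Fin p → ℝ) :
    IsUnit (jacFθ Z θ γ) := by
  rw [← Matrix.mulVec_injective_iff_isUnit, ← Matrix.coe_mulVecLin, injective_iff_map_eq_zero]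
  intro v hv
  rw [Matrix.mulVecLin_apply] at hv
  refine degree_eq_zero hn v fun i j hij => ?_
  rw [← predictor_degree Z]
  refine predictor_eq_zero_of_scorePairing Z (l := lam Z θ γ) (fun i j _ => Real.exp_pos _) ?_ hij
  rw [← jacobian_dotProduct]
  simp [hv]

/-- Each covariate direction `w` can be corrected by a degree direction `u` so that `(u, w)` is
orthogonal to all degree directions for the Fisher information. `H` is the information left in
the corrected directions. -/
theorem exists_efficient_direction (hn : 3 ≤ n) (θ : DegIdx n → ℝ) (γ w : Fin p → ℝ) :
    ∃ u : DegIdx n → ℝ, ∀ y : Param n p,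
      scorePairing Z (lam Z θ γ * predictor Z (u, w)) y = (H Z θ γ).mulVec w ⬝ᵥ y.2 := by
  have hV : IsUnit (jacFθ Z θ γ).det := (Matrix.isUnit_iff_isUnit_det _).1 (isUnit_jacFθ Z hn θ γ)
  refine ⟨-((jacFθ Z θ γ)⁻¹.mulVec ((jacFγ Z θ γ).mulVec w)), fun y => ?_⟩
  rw [← jacobian_dotProduct]
  have h1 : (jacFθ Z θ γ).mulVec ((jacFθ Z θ γ)⁻¹.mulVec ((jacFγ Z θ γ).mulVec w))
      = (jacFγ Z θ γ).mulVec w := by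
    rw [Matrix.mulVec_mulVec, Matrix.mul_nonsing_inv _ hV, Matrix.one_mulVec]
  simp only [Matrix.mulVec_neg, h1, neg_add_cancel, zero_dotProduct, zero_add]
  congr 1
  rw [H, Matrix.sub_mulVec, ← Matrix.mulVec_mulVec, ← Matrix.mulVec_mulVec, neg_add_eq_sub]

theorem predictor_injective (hn : 3 ≤ n) {θ : DegIdx n → ℝ} {γ : Fin p → ℝ}
    (hH : (H Z θ γ).PosDef) {x : Param n p} (h : ∀ i j, i ≠ j → predictor Z x i j = 0) :
    x = 0 := by
  obtain ⟨v, w⟩ := x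
  obtain ⟨u, hu⟩ := exists_efficient_direction Z hn θ γ w
  have h0 : (H Z θ γ).mulVec w ⬝ᵥ w = 0 := by
    rw [← hu (v, w), scorePairing_apply]
    exact Finset.sum_eq_zero fun e _ => by rw [h _ _ e.2, mul_zero]
  have hw : w = 0 := by
    by_contra hw
    have := hH.dotProduct_mulVec_pos hw
    rw [star_trivial, dotProduct_comm, h0] at this
    exact lt_irrefl _ this
  subst hw
  have hv : v = 0 := degree_eq_zero hn v fun i j hij => by
    rw [← predictor_degree Z]; exact h i j hij
  rw [hv]; rfl

/-- Weighted least squares on the edges: for positive weights `l`, each edge function `g` has a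
unique `S g` whose predictor, weighted by `l`, pairs with all directions as `g` does. -/
theorem exists_weighted_solution {l : Fin n → Fin n → ℝ} (hl : ∀ i j, i ≠ j → 0 < l i j)
    (hinj : ∀ x : Param n p, (∀ i j, i ≠ j → predictor Z x i j = 0) → x = 0) :
    ∃ S : (Fin n → Fin n → ℝ) →ₗ[ℝ] Param n p,
      (∀ g, scorePairing Z (l * predictor Z (S g)) = scorePairing Z g) ∧
      (∀ x, S (l * predictor Z x) = x) := by
  let G : Param n p →ₗ[ℝ] Module.Dual ℝ (Param n p) :=
    scorePairing Z ∘ₗ LinearMap.mulLeft ℝ l ∘ₗ predictor Z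
  have hG : ∀ x, G x = scorePairing Z (l * predictor Z x) := fun x => rfl
  have hGi : Function.Injective G := by
    rw [injective_iff_map_eq_zero]
    intro x hx
    refine hinj x fun i j hij => predictor_eq_zero_of_scorePairing Z hl ?_ hij
    rw [← hG, hx]; rfl
  let e := G.linearEquivOfInjective hGi Subspace.dual_finrank_eq.symm
  have he : ∀ x, e x = G x := fun x => rfl
  refine ⟨e.symm.toLinearMap ∘ₗ scorePairing Z, fun g => ?_, fun x => ?_⟩
  · rw [← hG, ← he]
    simp
  · rw [LinearMap.comp_apply, ← hG, ← he]
    simp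

end

/-! ### Two-way additive model -/

theorem card_filter_ne {n : ℕ} (i : Fin n) :
    (((Finset.univ.filter fun j : Fin n => j ≠ i).card : ℕ) : ℝ) = n - 1 := by
  rw [Finset.filter_ne', Finset.card_erase_of_mem (Finset.mem_univ i), Finset.card_univ,
    Fintype.card_fin, Nat.cast_pred (by have := i.2; omega)]

/-- The case `max α + min β ≥ 0` of `abs_add_le_of_row_col_sums`. -/
theorem abs_add_le_of_row_col_sums_of_nonneg {n : ℕ} {l : Fin n → Fin n → ℝ} {α β : Fin n → ℝ}
    {m M Y : ℝ} (hn : 2 ≤ n) (hm : 0 < m) (hl : ∀ i j, i ≠ j → m ≤ l i j ∧ l i j ≤ M)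
    (hM : 2 * M ≤ m * (n - 1))
    (hrow : ∀ i, |∑ j with j ≠ i, l i j * (α i + β j)| ≤ Y)
    (hcol : ∀ j, |∑ i with i ≠ j, l i j * (α i + β j)| ≤ Y)
    {i₁ j₀ : Fin n} (hi₁ : ∀ i, α i ≤ α i₁) (hj₀ : ∀ j, β j₀ ≤ β j) (hs : 0 ≤ α i₁ + β j₀)
    (i j : Fin n) :
    |α i + β j| ≤ 7 * (M / m) ^ 2 * (Y / ((n - 1) * m)) := by
  have hmM : m ≤ M := by
    obtain ⟨a, b, hab⟩ : ∃ a b : Fin n, a ≠ b :=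
      ⟨⟨0, by omega⟩, ⟨1, by omega⟩, by simp⟩
    exact (hl a b hab).1.trans (hl a b hab).2
  have hN : (0 : ℝ) < n - 1 := by
    have : (2 : ℝ) ≤ n := by exact_mod_cast hn
    linarith
  obtain ⟨s, hs'⟩ : ∃ s, s = α i₁ + β j₀ := ⟨_, rfl⟩
  obtain ⟨u, hu⟩ : ∃ u : Fin n → ℝ, u = fun i => α i₁ - α i := ⟨_, rfl⟩
  obtain ⟨v, hv⟩ : ∃ v : Fin n → ℝ, v = fun j => β j - β j₀ := ⟨_, rfl⟩
  have hx : ∀ i j, α i + β j = s - u i + v j := fun i j => by rw [hs', hu, hv]; ring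
  have hu0 : ∀ i, 0 ≤ u i := fun i => by rw [hu]; linarith [hi₁ i]
  have hv0 : ∀ j, 0 ≤ v j := fun j => by rw [hv]; linarith [hj₀ j]
  have hui : u i₁ = 0 := by simp [hu]
  have hvj : v j₀ = 0 := by simp [hv]
  rw [← hs'] at hs
  simp only [hx] at hrow hcol ⊢
  set U := ∑ i with i ≠ j₀, u i with hU
  set V := ∑ j with j ≠ i₁, v j with hV
  have hV0 : 0 ≤ V := Finset.sum_nonneg fun j _ => hv0 j
  have hsumU : ∀ j, ∑ i with i ≠ j, u i ≤ U + u j₀ := by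
    intro j
    have h1 : ∑ i with i ≠ j, u i ≤ ∑ i, u i :=
      Finset.sum_le_sum_of_subset_of_nonneg (Finset.filter_subset _ _) fun i _ _ => hu0 i
    have h2 : U + u j₀ = ∑ i, u i := by
      rw [hU, Finset.filter_ne', Finset.sum_erase_add _ _ (Finset.mem_univ _)]
    exact h1.trans_eq h2.symm
  have hsumV : ∀ i, ∑ j with j ≠ i, v j ≤ V + v i₁ := by
    intro i
    have h1 : ∑ j with j ≠ i, v j ≤ ∑ j, v j :=
      Finset.sum_le_sum_of_subset_of_nonneg (Finset.filter_subset _ _) fun i _ _ => hv0 i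
    have h2 : V + v i₁ = ∑ j, v j := by
      rw [hV, Finset.filter_ne', Finset.sum_erase_add _ _ (Finset.mem_univ _)]
    exact h1.trans_eq h2.symm
  -- the row of the maximal `α`: all terms are nonnegative
  have h1 : m * ((n - 1) * s + V) ≤ Y := by
    refine le_trans ?_ ((le_abs_self _).trans (hrow i₁))
    have : m * ((n - 1) * s + V) = ∑ j with j ≠ i₁, m * (s + v j) := by
      rw [← Finset.mul_sum, Finset.sum_add_distrib, Finset.sum_const, nsmul_eq_mul,
        card_filter_ne]
    rw [this]
    refine Finset.sum_le_sum fun j hj => ?_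
    rw [hui, sub_zero]
    exact mul_le_mul_of_nonneg_right (hl _ _ (Finset.mem_filter.1 hj).2.symm).1
      (add_nonneg hs (hv0 j))
  -- the column of the minimal `β`
  have h2 : m * U - (n - 1) * (M * s) ≤ Y := by
    refine le_trans ?_ ((neg_le_abs _).trans (hcol j₀))
    have : m * U - (n - 1) * (M * s) = ∑ i with i ≠ j₀, (m * u i - M * s) := by
      rw [Finset.sum_sub_distrib, ← Finset.mul_sum, Finset.sum_const, nsmul_eq_mul,
        card_filter_ne]
    rw [this, ← Finset.sum_neg_distrib]
    refine Finset.sum_le_sum fun i hi => ?_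
    have hli := hl _ _ (Finset.mem_filter.1 hi).2
    rw [hvj]
    have ha := mul_le_mul_of_nonneg_right hli.1 (hu0 i)
    have hb := mul_le_mul_of_nonneg_right hli.2 hs
    linarith
  have h3 : ∀ j, (n - 1) * (m * v j) - M * (U + u j₀) ≤ Y := by
    intro j
    refine le_trans ?_ ((le_abs_self _).trans (hcol j))
    have : (n - 1) * (m * v j) - M * ∑ i with i ≠ j, u i
        = ∑ i with i ≠ j, (m * v j - M * u i) := by
      rw [Finset.sum_sub_distrib, Finset.sum_const, nsmul_eq_mul, card_filter_ne,
        ← Finset.mul_sum]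
    refine le_trans (sub_le_sub_left
      (mul_le_mul_of_nonneg_left (hsumU j) (hm.le.trans hmM)) _) ?_
    rw [this]
    refine Finset.sum_le_sum fun i hi => ?_
    have hli := hl _ _ (Finset.mem_filter.1 hi).2
    have ha := mul_le_mul_of_nonneg_right hli.1 (hv0 j)
    have hb := mul_le_mul_of_nonneg_right hli.2 (hu0 i)
    have hc := mul_nonneg (hm.le.trans hli.1) hs
    linarith
  have h4 : ∀ i, (n - 1) * (m * u i) - M * ((n - 1) * s + V + v i₁) ≤ Y := by
    intro i
    refine le_trans ?_ ((neg_le_abs _).trans (hrow i))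
    have : (n - 1) * (m * u i) - M * ((n - 1) * s + ∑ j with j ≠ i, v j)
        = ∑ j with j ≠ i, (m * u i - M * (s + v j)) := by
      rw [Finset.sum_sub_distrib, Finset.sum_const, nsmul_eq_mul, card_filter_ne,
        ← Finset.mul_sum, Finset.sum_add_distrib, Finset.sum_const, nsmul_eq_mul, card_filter_ne]
    have hV' : (n - 1) * s + ∑ j with j ≠ i, v j ≤ (n - 1) * s + V + v i₁ := by
      linarith [hsumV i]
    refine le_trans (sub_le_sub_left
      (mul_le_mul_of_nonneg_left hV' (hm.le.trans hmM)) _) ?_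
    rw [this, ← Finset.sum_neg_distrib]
    refine Finset.sum_le_sum fun j hj => ?_
    have hli := hl _ _ (Finset.mem_filter.1 hj).2.symm
    have ha := mul_le_mul_of_nonneg_right hli.1 (hu0 i)
    have hb := mul_le_mul_of_nonneg_right hli.2 (add_nonneg hs (hv0 j))
    linarith
  -- normalize by the lower bound `(n - 1) m` of the row sums of the weights
  obtain ⟨R, hR⟩ : ∃ R, R = M / m := ⟨_, rfl⟩
  obtain ⟨t, ht⟩ : ∃ t, t = Y / ((n - 1) * m) := ⟨_, rfl⟩
  have hMR : M = R * m := by rw [hR]; field_simp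
  have hYt : Y = t * ((n - 1) * m) := by rw [ht]; field_simp
  have hR1 : 1 ≤ R := by rw [hR, le_div_iff₀ hm]; linarith
  rw [← hR, ← ht]
  rw [hMR, hYt] at h2 h3 h4
  rw [hYt] at h1
  have hRN : R / (n - 1) ≤ 1 / 2 := by
    rw [div_le_div_iff₀ hN two_pos]
    rw [hMR] at hM
    have : m * (R * 2) ≤ m * (1 * (n - 1)) := by linarith
    exact le_of_mul_le_mul_left this hm
  have k1 : s + V / (n - 1) ≤ t := by
    have : m * (n - 1) * (s + V / (n - 1)) ≤ m * (n - 1) * t := by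
      have : m * (n - 1) * (s + V / (n - 1)) = m * ((n - 1) * s + V) := by field_simp
      linarith
    exact le_of_mul_le_mul_left this (by positivity)
  have k2 : U / (n - 1) ≤ t + R * s := by
    have : m * (n - 1) * (U / (n - 1)) ≤ m * (n - 1) * (t + R * s) := by
      have : m * (n - 1) * (U / (n - 1)) = m * U := by field_simp
      linarith
    exact le_of_mul_le_mul_left this (by positivity)
  have k3 : ∀ j, v j ≤ t + R * (U / (n - 1)) + R / (n - 1) * u j₀ := by
    intro j
    have : m * (n - 1) * v j
        ≤ m * (n - 1) * (t + R * (U / (n - 1)) + R / (n - 1) * u j₀) := by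
      have : m * (n - 1) * (t + R * (U / (n - 1)) + R / (n - 1) * u j₀)
        = m * (n - 1) * t + m * R * U + m * R * u j₀ := by field_simp
      linarith [h3 j]
    exact le_of_mul_le_mul_left this (by positivity)
  have k4 : ∀ i, u i ≤ t + R * (s + V / (n - 1)) + R / (n - 1) * v i₁ := by
    intro i
    have : m * (n - 1) * u i
        ≤ m * (n - 1) * (t + R * (s + V / (n - 1)) + R / (n - 1) * v i₁) := by
      have : m * (n - 1) * (t + R * (s + V / (n - 1)) + R / (n - 1) * v i₁)
        = m * (n - 1) * t + m * R * (n - 1) * s + m * R * V + m * R * v i₁ := by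
        field_simp
        ring
      linarith [h4 i]
    exact le_of_mul_le_mul_left this (by positivity)
  have hR0 : 0 ≤ R := by linarith
  have hVN : 0 ≤ V / (n - 1) := by positivity
  have hst : s ≤ t := by linarith
  have ht0 : 0 ≤ t := hs.trans hst
  have htR : t ≤ R * t := le_mul_of_one_le_left ht0 hR1
  have htR2 : R * t ≤ R ^ 2 * t := by
    rw [pow_two, mul_assoc]; exact mul_le_mul_of_nonneg_left htR hR0
  have k2' : R * (U / (n - 1)) ≤ 2 * (R ^ 2 * t) := by
    have h := mul_le_mul_of_nonneg_left k2 hR0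
    have h' := mul_le_mul_of_nonneg_left hst (mul_nonneg hR0 hR0)
    have e : R * (t + R * s) = R * t + R * R * s := by ring
    have e' : R * R * t = R ^ 2 * t := by ring
    linarith
  have k4' : R * (s + V / (n - 1)) ≤ R * t := mul_le_mul_of_nonneg_left k1 hR0
  have hcu : R / (n - 1) * u j₀ ≤ 1 / 2 * u j₀ := mul_le_mul_of_nonneg_right hRN (hu0 _)
  have hcv : R / (n - 1) * v i₁ ≤ 1 / 2 * v i₁ := mul_le_mul_of_nonneg_right hRN (hv0 _)
  have a1 := k3 i₁
  have a2 := k4 j₀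
  have a3 := k3 j
  have a4 := k4 i
  have a5 := hu0 i
  have a6 := hv0 j
  rw [abs_le]
  constructor <;> linarith

/-- Stability in sup norm of the two-way additive model. If the weights `l` lie between `m` and
`M`, then the sums `α_i + β_j` are bounded by the weighted row and column sums they produce. The
reason is a maximum principle: where `α` is maximal and `β` is minimal, all terms of the sums have
a sign, which bounds the mean deviation of `α` and `β` from these extremes. -/
theorem abs_add_le_of_row_col_sums {n : ℕ} {l : Fin n → Fin n → ℝ} {α β : Fin n → ℝ}
    {m M Y : ℝ} (hn : 2 ≤ n) (hm : 0 < m) (hl : ∀ i j, i ≠ j → m ≤ l i j ∧ l i j ≤ M)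
    (hM : 2 * M ≤ m * (n - 1))
    (hrow : ∀ i, |∑ j with j ≠ i, l i j * (α i + β j)| ≤ Y)
    (hcol : ∀ j, |∑ i with i ≠ j, l i j * (α i + β j)| ≤ Y) (i j : Fin n) :
    |α i + β j| ≤ 7 * (M / m) ^ 2 * (Y / ((n - 1) * m)) := by
  have : Nonempty (Fin n) := ⟨i⟩
  obtain ⟨i₁, hi₁⟩ := Finite.exists_max α
  obtain ⟨j₀, hj₀⟩ := Finite.exists_min β
  rcases le_total 0 (α i₁ + β j₀) with hs | hs
  · exact abs_add_le_of_row_col_sums_of_nonneg hn hm hl hM hrow hcol hi₁ hj₀ hs i j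
  · -- exchanging the roles of rows and columns changes the sign of `max α + min β`
    have e : ∀ a b, -β a + -α b = -(α b + β a) := fun a b => by ring
    have h := abs_add_le_of_row_col_sums_of_nonneg (l := fun a b => l b a) (α := fun a => -β a)
      (β := fun b => -α b) (M := M) (Y := Y) hn hm (fun a b hab => hl b a hab.symm) hM
      (fun a => by simpa only [e, mul_neg, Finset.sum_neg_distrib, abs_neg] using hcol a)
      (fun a => by simpa only [e, mul_neg, Finset.sum_neg_distrib, abs_neg] using hrow a)
      (fun a => neg_le_neg (hj₀ a)) (fun a => neg_le_neg (hi₁ a)) (by linarith) j i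
    rwa [e, abs_neg] at h

theorem abs_row_sum_le {n : ℕ} {g : Fin n → Fin n → ℝ} {c : ℝ}
    (hg : ∀ i j, i ≠ j → |g i j| ≤ c) (i : Fin n) : |∑ j with j ≠ i, g i j| ≤ (n - 1) * c := by
  refine (Finset.abs_sum_le_sum_abs _ _).trans ?_
  refine (Finset.sum_le_card_nsmul _ _ c fun j hj =>
    hg i j (Finset.mem_filter.1 hj).2.symm).trans ?_
  rw [nsmul_eq_mul, card_filter_ne]

theorem abs_col_sum_le {n : ℕ} {g : Fin n → Fin n → ℝ} {c : ℝ}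
    (hg : ∀ i j, i ≠ j → |g i j| ≤ c) (j : Fin n) : |∑ i with i ≠ j, g i j| ≤ (n - 1) * c :=
  abs_row_sum_le (g := fun a b => g b a) (fun a b hab => hg b a hab.symm) j

theorem card_edge_le (n : ℕ) : (Fintype.card (Edge n) : ℝ) ≤ (n : ℝ) ^ 2 := by
  have := Fintype.card_subtype_le fun e : Fin n × Fin n => e.1 ≠ e.2
  rw [Fintype.card_prod, Fintype.card_fin] at this
  rw [pow_two]
  exact_mod_cast this

theorem sum_edge_le {n : ℕ} {f : Edge n → ℝ} {c : ℝ} (hc : 0 ≤ c) (hf : ∀ e, f e ≤ c) :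
    ∑ e, f e ≤ (n : ℝ) ^ 2 * c := by
  refine (Finset.sum_le_card_nsmul _ _ c fun e _ => hf e).trans ?_
  rw [nsmul_eq_mul, Finset.card_univ]
  exact mul_le_mul_of_nonneg_right (card_edge_le n) hc

/-! ### Sup norm stability of weighted least squares -/

section
variable {n p : ℕ} (Z : Fin n → Fin n → Fin p → ℝ)

/-- The standing bounds at the true parameter: covariates bounded by `q`, intensities between
`E⁻¹` and `E` (where `E = exp ρ`). -/
structure Bounds (θ : DegIdx n → ℝ) (γ : Fin p → ℝ) (q E : ℝ) : Prop where
  three_le : 3 ≤ n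
  one_le_q : 1 ≤ q
  one_le_E : 1 ≤ E
  cov : ∀ i j, i ≠ j → ∀ k, |Z i j k| ≤ q
  lam_bounds : ∀ i j, i ≠ j → E⁻¹ ≤ lam Z θ γ i j ∧ lam Z θ γ i j ≤ E

namespace Bounds
variable {Z} {θ : DegIdx n → ℝ} {γ : Fin p → ℝ} {q E : ℝ}

theorem E_pos (h : Bounds Z θ γ q E) : 0 < E := one_pos.trans_le h.one_le_E

theorem q_pos (h : Bounds Z θ γ q E) : 0 < q := one_pos.trans_le h.one_le_q

theorem pred_pos (h : Bounds Z θ γ q E) : (0 : ℝ) < n - 1 := by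
  have : (3 : ℝ) ≤ n := by exact_mod_cast h.three_le
  linarith

theorem lam_pos (_ : Bounds Z θ γ q E) (i j : Fin n) : 0 < lam Z θ γ i j := Real.exp_pos _

theorem abs_covSum_le (h : Bounds Z θ γ q E) (w : Fin p → ℝ) {i j : Fin n} (hij : i ≠ j) :
    |∑ k, Z i j k * w k| ≤ p * q * ‖w‖ := by
  refine (Finset.abs_sum_le_sum_abs _ _).trans ?_
  refine (Finset.sum_le_card_nsmul _ _ (q * ‖w‖) fun k _ => ?_).trans ?_
  · rw [abs_mul]
    exact mul_le_mul (h.cov i j hij k) (norm_le_pi_norm w k) (abs_nonneg _) h.q_pos.le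
  · simp [mul_assoc]

theorem abs_predictor_le (h : Bounds Z θ γ q E) (x : Param n p) {i j : Fin n} (hij : i ≠ j) :
    |predictor Z x i j| ≤ (2 + p * q) * ‖x‖ := by
  obtain ⟨v, w⟩ := x
  have h1 : |alpha v i| ≤ ‖v‖ := norm_le_pi_norm v (Sum.inl i)
  have h2 : |beta v j| ≤ ‖v‖ := by
    unfold beta
    split_ifs
    · exact norm_le_pi_norm v _
    · simp
  have h3 := h.abs_covSum_le w hij
  have hv : ‖v‖ ≤ ‖(v, w)‖ := norm_fst_le (v, w)
  have hw : ‖w‖ ≤ ‖(v, w)‖ := norm_snd_le (v, w)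
  have hpq : 0 ≤ p * q := mul_nonneg (Nat.cast_nonneg _) h.q_pos.le
  rw [predictor_eq_add]
  refine (abs_add_three _ _ _).trans ?_
  have := mul_le_mul_of_nonneg_left hw hpq
  linarith

/-- Weighted least squares in the degree directions alone. Since the data enter through all `n`
row and all `n` column sums, no factor `n` is lost at the node with `β_n = 0`. -/
theorem abs_degree_le (h : Bounds Z θ γ q E) (hsq : 2 * E ^ 2 ≤ n - 1)
    {v : DegIdx n → ℝ} {g : Fin n → Fin n → ℝ} {Y : ℝ}
    (hv : ∀ v' : DegIdx n → ℝ,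
      scorePairing Z (lam Z θ γ * predictor Z (v, 0) - g) (v', 0) = 0)
    (hrow : ∀ i, |∑ j with j ≠ i, g i j| ≤ (n - 1) * Y)
    (hcol : ∀ j, |∑ i with i ≠ j, g i j| ≤ (n - 1) * Y) (i j : Fin n) :
    |alpha v i + beta v j| ≤ 7 * E ^ 5 * Y := by
  obtain ⟨h1, h2⟩ := row_col_sum_eq_zero Z hv
  have hE := h.E_pos
  have hN := h.pred_pos
  simp only [Pi.sub_apply, Pi.mul_apply, predictor_degree, Finset.sum_sub_distrib,
    sub_eq_zero] at h1 h2
  have key := abs_add_le_of_row_col_sums (l := lam Z θ γ) (α := alpha v) (β := beta v)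
    (m := E⁻¹) (M := E) (Y := (n - 1) * Y) (by linarith [h.three_le]) (inv_pos.2 hE) h.lam_bounds
    (by rw [inv_mul_eq_div, le_div_iff₀ hE]; linarith)
    (fun i => by rw [h1]; exact hrow i) (fun j => by rw [h2]; exact hcol j) i j
  refine key.trans_eq ?_
  field_simp

/-- The corrected covariate directions have bounded predictors, and pair with the Fisher
information as the rows of `H`. -/
theorem exists_efficient_basis (h : Bounds Z θ γ q E) (hsq : 2 * E ^ 2 ≤ n - 1)
    (hH : (H Z θ γ).PosDef) :
    ∃ R : Fin p → Param n p,
      (∀ k i j, i ≠ j → |predictor Z (R k) i j| ≤ 8 * E ^ 6 * q) ∧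
      ∀ k x, scorePairing Z (lam Z θ γ * predictor Z x) (R k) = (H Z θ γ).mulVec x.2 k := by
  choose U hU using fun k : Fin p => exists_efficient_direction Z h.three_le θ γ (Pi.single k 1)
  have hE := h.E_pos
  have hq := h.q_pos
  refine ⟨fun k => (U k, Pi.single k 1), fun k i j hij => ?_, fun k x => ?_⟩
  · have hsplit : ∀ i j, predictor Z (U k, Pi.single k 1) i j
        = predictor Z (U k, 0) i j + Z i j k := by
      intro i j
      simp [predictor_apply, linPred, Pi.single_apply]
    have hg : ∀ i j, i ≠ j → |-(lam Z θ γ i j * Z i j k)| ≤ E * q := by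
      intro i j hij
      rw [abs_neg, abs_mul, abs_of_pos (h.lam_pos i j)]
      exact mul_le_mul (h.lam_bounds i j hij).2 (h.cov i j hij k) (abs_nonneg _) hE.le
    have hb := h.abs_degree_le hsq (v := U k) (g := fun i j => -(lam Z θ γ i j * Z i j k))
      (Y := E * q) (fun v' => by
        have := hU k (v', 0)
        simp only [dotProduct_zero] at this
        rw [← this]
        congr 2
        funext i j
        simp only [Pi.sub_apply, Pi.mul_apply, hsplit]
        ring) (fun i => abs_row_sum_le hg i) (fun j => abs_col_sum_le hg j) i j
    rw [hsplit, predictor_degree]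
    refine (abs_add_le _ _).trans ?_
    have hE6 : 1 * q ≤ E ^ 6 * q := mul_le_mul_of_nonneg_right (one_le_pow₀ h.one_le_E) hq.le
    have := h.cov i j hij k
    have e : 7 * E ^ 5 * (E * q) = 7 * (E ^ 6 * q) := by ring
    linarith
  · rw [scorePairing_mul_comm, hU k x, Matrix.mulVec_single_one]
    refine Finset.sum_congr rfl fun l _ => ?_
    have := hH.isHermitian.apply k l
    rw [star_trivial] at this
    rw [Matrix.col_apply, this]

section
attribute [local instance] Matrix.linftyOpNormedAddCommGroup

theorem norm_le_matNorm_inv {A : Matrix (Fin p) (Fin p) ℝ} (hA : A.PosDef) (w : Fin p → ℝ) :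
    ‖w‖ ≤ matNorm A⁻¹ * ‖A.mulVec w‖ := by
  have hu : IsUnit A.det := (Matrix.isUnit_iff_isUnit_det _).1 hA.isUnit
  have h : A⁻¹.mulVec (A.mulVec w) = w := by
    rw [Matrix.mulVec_mulVec, Matrix.nonsing_inv_mul _ hu, Matrix.one_mulVec]
  calc ‖w‖ = ‖A⁻¹.mulVec (A.mulVec w)‖ := by rw [h]
    _ ≤ _ := Matrix.linfty_opNorm_mulVec _ _

theorem matNorm_nonneg (A : Matrix (Fin p) (Fin p) ℝ) : 0 ≤ matNorm A := norm_nonneg A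

end

/-- Since `‖H⁻¹‖ ≤ κ / n²`, the covariate part is at most `κ` times the average pairing of the
data with the corrected covariate directions. -/
theorem norm_covariate_le (h : Bounds Z θ γ q E) (hH : (H Z θ γ).PosDef) {κ : ℝ}
    (hκ : matNorm (H Z θ γ)⁻¹ ≤ κ / (n : ℝ) ^ 2) {w : Fin p → ℝ} {T : ℝ} (hT : 0 ≤ T)
    (hw : ∀ k, |(H Z θ γ).mulVec w k| ≤ (n : ℝ) ^ 2 * T) : ‖w‖ ≤ κ * T := by
  have hn : (0 : ℝ) < n := by have := h.pred_pos; linarith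
  have h1 : ‖(H Z θ γ).mulVec w‖ ≤ (n : ℝ) ^ 2 * T :=
    (pi_norm_le_iff_of_nonneg (by positivity)).2 hw
  calc ‖w‖ ≤ matNorm (H Z θ γ)⁻¹ * ‖(H Z θ γ).mulVec w‖ := norm_le_matNorm_inv hH w
    _ ≤ κ / (n : ℝ) ^ 2 * ((n : ℝ) ^ 2 * T) :=
      mul_le_mul hκ h1 (norm_nonneg _) ((matNorm_nonneg _).trans hκ)
    _ = κ * T := by field_simp

/-- `H` is dominated by the information of the covariates alone, which is at most `n² E q²`.
Hence the bound `κ` on its inverse cannot be small. -/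
theorem one_le_kappa (h : Bounds Z θ γ q E) (hp : 0 < p) (hH : (H Z θ γ).PosDef) {κ : ℝ}
    (hκ : matNorm (H Z θ γ)⁻¹ ≤ κ / (n : ℝ) ^ 2) : 1 ≤ κ * (E * q ^ 2) := by
  have hE := h.E_pos
  let k : Fin p := ⟨0, hp⟩
  obtain ⟨u, hu⟩ := exists_efficient_direction Z h.three_le θ γ (Pi.single k 1)
  set r : Fin n → Fin n → ℝ := predictor Z (u, Pi.single k 1) with hr
  have hZl : ∀ (l : Fin p) i j, predictor Z ((0 : DegIdx n → ℝ), Pi.single l 1) i j = Z i j l := by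
    intro l i j
    simp [predictor_apply, linPred, alpha, beta, Pi.single_apply]
  have hrow : ∀ l, (H Z θ γ).mulVec (Pi.single k 1) l
      = ∑ e : Edge n, lam Z θ γ e.1.1 e.1.2 * (r e.1.1 e.1.2 * Z e.1.1 e.1.2 l) := by
    intro l
    have := hu (0, Pi.single l 1)
    simp only [dotProduct_single, mul_one] at this
    rw [← this, scorePairing_apply]
    simp only [Pi.mul_apply, hZl, mul_assoc]
  -- orthogonality: the corrected direction has less information than the covariate itself
  have hself : ∑ e : Edge n, lam Z θ γ e.1.1 e.1.2 * (r e.1.1 e.1.2 * r e.1.1 e.1.2)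
      = ∑ e : Edge n, lam Z θ γ e.1.1 e.1.2 * (r e.1.1 e.1.2 * Z e.1.1 e.1.2 k) := by
    have := hu (u, Pi.single k 1)
    simp only [dotProduct_single, mul_one] at this
    rw [← hrow, ← this, scorePairing_apply]
    simp only [Pi.mul_apply, mul_assoc, hr]
  have hamgm : ∀ l, |∑ e : Edge n, lam Z θ γ e.1.1 e.1.2 * (r e.1.1 e.1.2 * Z e.1.1 e.1.2 l)|
      ≤ 1 / 2 * ∑ e : Edge n, lam Z θ γ e.1.1 e.1.2 * (r e.1.1 e.1.2 * r e.1.1 e.1.2)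
        + 1 / 2 * ((n : ℝ) ^ 2 * (E * q ^ 2)) := by
    intro l
    have hs : ∑ e : Edge n, lam Z θ γ e.1.1 e.1.2 * Z e.1.1 e.1.2 l ^ 2
        ≤ (n : ℝ) ^ 2 * (E * q ^ 2) := by
      refine sum_edge_le (by positivity) fun e => ?_
      exact mul_le_mul (h.lam_bounds _ _ e.2).2
        (sq_le_sq.2 (by rw [abs_of_pos h.q_pos]; exact h.cov _ _ e.2 l)) (by positivity) hE.le
    refine (Finset.abs_sum_le_sum_abs _ _).trans ?_
    refine le_trans ?_ (add_le_add_right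
      (mul_le_mul_of_nonneg_left hs (by norm_num : (0 : ℝ) ≤ 1 / 2)) _)
    rw [Finset.mul_sum, Finset.mul_sum, ← Finset.sum_add_distrib]
    refine Finset.sum_le_sum fun e _ => ?_
    rw [abs_mul, abs_of_pos (h.lam_pos _ _)]
    have h2 : |r e.1.1 e.1.2 * Z e.1.1 e.1.2 l|
        ≤ 1 / 2 * (r e.1.1 e.1.2 * r e.1.1 e.1.2) + 1 / 2 * Z e.1.1 e.1.2 l ^ 2 := by
      rw [abs_le]
      constructor <;> nlinarith [sq_nonneg (r e.1.1 e.1.2 + Z e.1.1 e.1.2 l),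
        sq_nonneg (r e.1.1 e.1.2 - Z e.1.1 e.1.2 l)]
    have := mul_le_mul_of_nonneg_left h2 (h.lam_pos e.1.1 e.1.2).le
    linarith
  have hrr : ∑ e : Edge n, lam Z θ γ e.1.1 e.1.2 * (r e.1.1 e.1.2 * r e.1.1 e.1.2)
      ≤ (n : ℝ) ^ 2 * (E * q ^ 2) := by
    have := (le_abs_self _).trans (hamgm k)
    rw [← hself] at this
    linarith
  have := h.norm_covariate_le hH hκ (w := Pi.single k 1) (T := E * q ^ 2) (by positivity)
    (fun l => by rw [hrow]; linarith [hamgm l])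
  have h1 := norm_le_pi_norm (Pi.single k 1 : Fin p → ℝ) k
  rw [Pi.single_eq_same, norm_one] at h1
  exact h1.trans this

/-- Sup norm stability of weighted least squares, degree part: the covariate part `w` acts as an
additional term of the data. -/
theorem norm_degree_le (h : Bounds Z θ γ q E) (hsq : 2 * E ^ 2 ≤ n - 1)
    {v : DegIdx n → ℝ} {w : Fin p → ℝ} {g : Fin n → Fin n → ℝ} {Y : ℝ}
    (hx : scorePairing Z (lam Z θ γ * predictor Z (v, w)) = scorePairing Z g)
    (hrow : ∀ i, |∑ j with j ≠ i, g i j| ≤ (n - 1) * Y)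
    (hcol : ∀ j, |∑ i with i ≠ j, g i j| ≤ (n - 1) * Y) :
    ‖v‖ ≤ 14 * E ^ 5 * (Y + p * q * E * ‖w‖) := by
  have hE := h.E_pos
  have hc : ∀ i j, i ≠ j → |lam Z θ γ i j * ∑ k, Z i j k * w k| ≤ p * q * E * ‖w‖ := by
    intro i j hij
    rw [abs_mul, abs_of_pos (h.lam_pos i j)]
    refine (mul_le_mul (h.lam_bounds i j hij).2 (h.abs_covSum_le w hij) (abs_nonneg _)
      hE.le).trans_eq ?_
    ring
  have hb := fun i j => h.abs_degree_le hsq (v := v)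
    (g := fun i j => g i j - lam Z θ γ i j * ∑ k, Z i j k * w k) (Y := Y + p * q * E * ‖w‖)
    (fun v' => by
      have h0 := LinearMap.congr_fun hx (v', 0)
      rw [← sub_eq_zero, ← LinearMap.sub_apply, ← map_sub] at h0
      rw [← h0]
      congr 2
      funext i j
      simp only [Pi.sub_apply, Pi.mul_apply, predictor_degree]
      rw [predictor_eq_add]
      ring)
    (fun i => by
      rw [Finset.sum_sub_distrib]
      refine (abs_sub _ _).trans ?_
      have := abs_row_sum_le hc i
      have := hrow i
      linarith)
    (fun j => by
      rw [Finset.sum_sub_distrib]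
      refine (abs_sub _ _).trans ?_
      have := abs_col_sum_le hc j
      have := hcol j
      linarith) i j
  refine (PoissonNetwork.norm_degree_le (by linarith [h.three_le]) v hb).trans_eq ?_
  ring

end Bounds
end

/-! ### Existence of the MLE near the true parameter -/

/-- Linearization of `exp` near `0`. -/
theorem abs_exp_sub_exp_sub_le {a c ρ : ℝ} (ha : |a| ≤ ρ) (hc : |c| ≤ ρ) (hρ : ρ ≤ 1) :
    |Real.exp a - Real.exp c - (a - c)| ≤ 2 * ρ * |a - c| := by
  have key : ∀ x y : ℝ, |x| ≤ ρ → Real.exp x - Real.exp y - (x - y) ≤ 2 * ρ * |x - y| := by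
    intro x y hx
    have h1 : Real.exp x - Real.exp y ≤ Real.exp x * (x - y) := by
      have := mul_le_mul_of_nonneg_left (Real.add_one_le_exp (y - x)) (Real.exp_pos x).le
      rw [← Real.exp_add, add_sub_cancel] at this
      linarith
    have h2 : |Real.exp x - 1| ≤ 2 * ρ :=
      (Real.abs_exp_sub_one_le (hx.trans hρ)).trans (by linarith)
    calc Real.exp x - Real.exp y - (x - y) ≤ (Real.exp x - 1) * (x - y) := by linarith
      _ ≤ |Real.exp x - 1| * |x - y| := by rw [← abs_mul]; exact le_abs_self _
      _ ≤ _ := mul_le_mul_of_nonneg_right h2 (abs_nonneg _)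
  rw [abs_le]
  constructor
  · have := key c a hc
    rw [abs_sub_comm c a] at this
    linarith
  · exact key a c ha

section
variable {n p : ℕ} {Z : Fin n → Fin n → Fin p → ℝ} {θ : DegIdx n → ℝ} {γ : Fin p → ℝ} {q E : ℝ}

/-- The noise level of the data: row and column sums of the centred weights, and their projected
covariate scores along the directions `R`. -/
structure NoiseBounds (Z : Fin n → Fin n → Fin p → ℝ) (A : Fin n → Fin n → ℕ) (θ : DegIdx n → ℝ)
    (γ : Fin p → ℝ) (R : Fin p → Param n p) (Y T : ℝ) : Prop where
  row : ∀ i, |∑ j with j ≠ i, ((A i j : ℝ) - lam Z θ γ i j)| ≤ (n - 1) * Y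
  col : ∀ j, |∑ i with i ≠ j, ((A i j : ℝ) - lam Z θ γ i j)| ≤ (n - 1) * Y
  proj : ∀ k, |scorePairing Z (fun i j => (A i j : ℝ) - lam Z θ γ i j) (R k)| ≤ (n : ℝ) ^ 2 * T

/-- The remainder of the linearization of the intensities at the true parameter is Lipschitz on a
ball of radius `r`, with a constant of order `r`. -/
theorem Bounds.abs_remainder_le (h : Bounds Z θ γ q E) {x y : Param n p} {r : ℝ}
    (hx : ‖x - (θ, γ)‖ ≤ r) (hy : ‖y - (θ, γ)‖ ≤ r) (hr : (2 + p * q) * r ≤ 1) {i j : Fin n}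
    (hij : i ≠ j) :
    |lam Z x.1 x.2 i j - lam Z y.1 y.2 i j - lam Z θ γ i j * predictor Z (x - y) i j|
      ≤ 2 * (2 + p * q) ^ 2 * E * r * ‖x - y‖ := by
  have hb : 0 ≤ 2 + p * q := by
    have := mul_nonneg (Nat.cast_nonneg (α := ℝ) p) h.q_pos.le
    linarith
  have hlam : ∀ z : Param n p, lam Z z.1 z.2 i j
      = lam Z θ γ i j * Real.exp (predictor Z (z - (θ, γ)) i j) := by
    intro z
    rw [← lam_add Z (θ, γ) (z - (θ, γ))]
    simp
  have hd : predictor Z (x - y) i j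
      = predictor Z (x - (θ, γ)) i j - predictor Z (y - (θ, γ)) i j := by
    rw [← Pi.sub_apply, ← Pi.sub_apply, ← map_sub, sub_sub_sub_cancel_right]
  have hx' := (h.abs_predictor_le (x - (θ, γ)) hij).trans (mul_le_mul_of_nonneg_left hx hb)
  have hy' := (h.abs_predictor_le (y - (θ, γ)) hij).trans (mul_le_mul_of_nonneg_left hy hb)
  have h1 := abs_exp_sub_exp_sub_le hx' hy' hr
  rw [← hd] at h1
  have h2 := h.abs_predictor_le (x - y) hij
  have hr0 : 0 ≤ r := (norm_nonneg _).trans hx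
  rw [hlam x, hlam y, ← mul_sub, ← mul_sub, abs_mul, abs_of_pos (h.lam_pos i j)]
  calc _ ≤ E * (2 * ((2 + p * q) * r) * ((2 + p * q) * ‖x - y‖)) :=
        mul_le_mul (h.lam_bounds i j hij).2
          (h1.trans (mul_le_mul_of_nonneg_left h2 (by positivity))) (abs_nonneg _) h.E_pos.le
    _ = _ := by ring

/-- Existence and location of the MLE for data with controlled noise. The preconditioned score
`x ↦ S (λ(x) - A)`, with `S` the weighted least squares solution map at the true parameter, is
close to the identity on a small sup norm ball, and so it has a zero there. Feeding the radius of
the ball back into the equation gives the sharper bound on the covariate parameter. -/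
theorem Bounds.exists_mle_near (h : Bounds Z θ γ q E) (hsq : 2 * E ^ 2 ≤ n - 1)
    (hp : 0 < p) (hH : (H Z θ γ).PosDef) {κ : ℝ}
    (hκ : matNorm (H Z θ γ)⁻¹ ≤ κ / (n : ℝ) ^ 2) {R : Fin p → Param n p}
    (hR : ∀ k i j, i ≠ j → |predictor Z (R k) i j| ≤ 8 * E ^ 6 * q)
    (hRH : ∀ k x, scorePairing Z (lam Z θ γ * predictor Z x) (R k) = (H Z θ γ).mulVec x.2 k)
    {A : Fin n → Fin n → ℕ} {τ δ : ℝ} (hτ : 0 ≤ τ)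
    (hA : NoiseBounds Z A θ γ R (5 * E * τ) (24 * q * E ^ 7 * τ ^ 2))
    (hδ : 100000 * ((1 + p) * q ^ 2 * (2 + p * q) ^ 2) * δ ≤ 1)
    (h1 : κ * E ^ 20 * τ ≤ δ) (h2 : E ^ 19 * τ ≤ δ) :
    ∃ x : Param n p, IsMLE Z A x.1 x.2 ∧ ‖x - (θ, γ)‖ ≤ 142 * E ^ 6 * τ ∧
      ‖x.2 - γ‖ ≤ 400000 * q * (2 + p * q) ^ 2 * (κ * E ^ 19 * τ ^ 2) := by
  have hE := h.E_pos
  have hE1 := h.one_le_E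
  have hq := h.q_pos
  have hq1 := h.one_le_q
  have hp0 : (0 : ℝ) ≤ p := Nat.cast_nonneg p
  have hκ0 : 0 < κ := by
    have := one_pos.trans_le (h.one_le_kappa hp hH hκ)
    exact pos_of_mul_pos_left this (by positivity)
  obtain ⟨b, hb⟩ : ∃ b, b = 2 + p * q := ⟨_, rfl⟩
  rw [← hb] at hδ ⊢
  have hb1 : 1 ≤ b := by rw [hb]; nlinarith
  have hδ0 : 0 ≤ δ := le_trans (by positivity) h2
  -- consequences of the smallness of `δ`
  have small : ∀ c, c ≤ (1 + p) * q ^ 2 * b ^ 2 → c * δ ≤ 1 / 100000 := by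
    intro c hc
    have := mul_le_mul_of_nonneg_right hc hδ0
    linarith
  have hqq : q ≤ q ^ 2 := by nlinarith
  have hq2 : 1 ≤ q ^ 2 := by nlinarith
  have hbb : b ≤ b ^ 2 := by nlinarith
  have hb2 : 1 ≤ b ^ 2 := by nlinarith
  have hqb : q ^ 2 * b ^ 2 ≤ (1 + p) * q ^ 2 * b ^ 2 := by
    have : 0 ≤ p * (q ^ 2 * b ^ 2) := by positivity
    linarith
  have s1 : b * δ ≤ 1 / 100000 := small _ (le_trans (by nlinarith) hqb)
  have s2 : b ^ 2 * δ ≤ 1 / 100000 := small _ (le_trans (by nlinarith) hqb)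
  have s3 : q * b ^ 2 * δ ≤ 1 / 100000 :=
    small _ (le_trans (mul_le_mul_of_nonneg_right hqq (by positivity)) hqb)
  have s4 : p * q ^ 2 * b ^ 2 * δ ≤ 1 / 100000 := small _ (by
    have : 0 ≤ q ^ 2 * b ^ 2 := by positivity
    linarith)
  have s5 : p * q ^ 2 * δ ≤ 1 / 100000 := small _ (by
    have h3 : p * q ^ 2 * 1 ≤ p * q ^ 2 * b ^ 2 := mul_le_mul_of_nonneg_left hb2 (by positivity)
    have : 0 ≤ q ^ 2 * b ^ 2 := by positivity
    linarith)
  have s6 : q * δ ≤ 1 / 100000 := small _ (le_trans (by nlinarith) hqb)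
  have eE : ∀ k, k ≤ 19 → E ^ k * τ ≤ δ := fun k hk =>
    (mul_le_mul_of_nonneg_right (pow_le_pow_right₀ hE1 hk) hτ).trans h2
  have eκ : ∀ k, k ≤ 20 → κ * E ^ k * τ ≤ δ := fun k hk =>
    (mul_le_mul_of_nonneg_right (mul_le_mul_of_nonneg_left (pow_le_pow_right₀ hE1 hk) hκ0.le)
      hτ).trans h1
  obtain ⟨S, hS, hS'⟩ := exists_weighted_solution Z (l := lam Z θ γ) (fun i j _ => h.lam_pos i j)
    (fun x => predictor_injective Z h.three_le hH)
  -- stability of `S`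
  have stab2 : ∀ {g : Fin n → Fin n → ℝ} {T : ℝ}, 0 ≤ T →
      (∀ k, |scorePairing Z g (R k)| ≤ (n : ℝ) ^ 2 * T) → ‖(S g).2‖ ≤ κ * T := by
    intro g T hT hg
    refine h.norm_covariate_le hH hκ hT fun k => ?_
    rw [← hRH k (S g), hS]
    exact hg k
  have stab1 : ∀ {g : Fin n → Fin n → ℝ} {Y : ℝ}, (∀ i, |∑ j with j ≠ i, g i j| ≤ (n - 1) * Y) →
      (∀ j, |∑ i with i ≠ j, g i j| ≤ (n - 1) * Y) →
      ‖(S g).1‖ ≤ 14 * E ^ 5 * (Y + p * q * E * ‖(S g).2‖) := by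
    intro g Y hrow hcol
    exact h.norm_degree_le hsq (hS g) hrow hcol
  have stabc2 : ∀ {g : Fin n → Fin n → ℝ} {c : ℝ}, 0 ≤ c → (∀ i j, i ≠ j → |g i j| ≤ c) →
      ‖(S g).2‖ ≤ κ * (8 * E ^ 6 * q * c) := by
    intro g c hc hg
    refine stab2 (by positivity) fun k => ?_
    rw [scorePairing_apply]
    refine (Finset.abs_sum_le_sum_abs _ _).trans (sum_edge_le (by positivity) fun e => ?_)
    rw [abs_mul, mul_comm]
    exact mul_le_mul (hR k _ _ e.2) (hg _ _ e.2) (abs_nonneg _) (by positivity)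
  -- twice the order of the degree part of `S (A - λ)`
  obtain ⟨r, hr⟩ : ∃ r, r = 142 * E ^ 6 * τ := ⟨_, rfl⟩
  have hr0 : 0 ≤ r := by rw [hr]; positivity
  have hbr : b * r ≤ 1 := by
    have := mul_le_mul_of_nonneg_left (eE 6 (by norm_num)) (by linarith : 0 ≤ b)
    have e : b * r = 142 * (b * (E ^ 6 * τ)) := by rw [hr]; ring
    linarith
  let f : Param n p → Param n p := fun x => S fun i j => lam Z x.1 x.2 i j - (A i j : ℝ)
  let rem : Param n p → Param n p → Fin n → Fin n → ℝ := fun x y i j =>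
    lam Z x.1 x.2 i j - lam Z y.1 y.2 i j - lam Z θ γ i j * predictor Z (x - y) i j
  have hrem : ∀ x y, f x - f y - (x - y) = S (rem x y) := by
    intro x y
    conv_lhs => rw [← hS' (x - y)]
    rw [← map_sub, ← map_sub]
    congr 1
    funext i j
    simp only [Pi.sub_apply, Pi.mul_apply, rem]
    ring
  have hrem_le : ∀ x y, ‖x - (θ, γ)‖ ≤ r → ‖y - (θ, γ)‖ ≤ r → ∀ i j, i ≠ j →
      |rem x y i j| ≤ 2 * b ^ 2 * E * r * ‖x - y‖ := by
    intro x y hx hy i j hij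
    have := h.abs_remainder_le hx hy (by rw [← hb]; exact hbr) hij
    rwa [← hb] at this
  have hcontr : ∀ x y, ‖x - (θ, γ)‖ ≤ r → ‖y - (θ, γ)‖ ≤ r →
      ‖S (rem x y)‖ ≤ 1 / 2 * ‖x - y‖ := by
    intro x y hx hy
    have hc := hrem_le x y hx hy
    have hc0 : 0 ≤ 2 * b ^ 2 * E * r * ‖x - y‖ := by positivity
    have k2 := stabc2 hc0 hc
    have k1 := stab1 (fun i => abs_row_sum_le hc i) (fun j => abs_col_sum_le hc j)
    have e2 : κ * (8 * E ^ 6 * q * (2 * b ^ 2 * E * r * ‖x - y‖))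
        = 2272 * (q * b ^ 2 * (κ * E ^ 13 * τ)) * ‖x - y‖ := by rw [hr]; ring
    have m2 := mul_le_mul_of_nonneg_left (eκ 13 (by norm_num))
      (by positivity : 0 ≤ q * b ^ 2)
    have m3 := mul_le_mul_of_nonneg_left (eE 12 (by norm_num)) (by positivity : 0 ≤ b ^ 2)
    have m4 := mul_le_mul_of_nonneg_left (eκ 19 (by norm_num))
      (by positivity : 0 ≤ p * q ^ 2 * b ^ 2)
    refine max_le ?_ ?_
    · refine k1.trans ?_
      calc _ ≤ 14 * E ^ 5 * (2 * b ^ 2 * E * r * ‖x - y‖ + p * q * E *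
            (κ * (8 * E ^ 6 * q * (2 * b ^ 2 * E * r * ‖x - y‖)))) := by gcongr
        _ = (3976 * (b ^ 2 * (E ^ 12 * τ)) + 31808 * (p * q ^ 2 * b ^ 2 * (κ * E ^ 19 * τ)))
            * ‖x - y‖ := by rw [hr]; ring
        _ ≤ 1 / 2 * ‖x - y‖ := mul_le_mul_of_nonneg_right (by linarith) (norm_nonneg _)
    · refine k2.trans ?_
      rw [e2]
      exact mul_le_mul_of_nonneg_right (by linarith) (norm_nonneg _)
  -- the preconditioned score at the true parameter
  have hnoise2 : ‖(S fun i j => (A i j : ℝ) - lam Z θ γ i j).2‖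
      ≤ κ * (24 * q * E ^ 7 * τ ^ 2) := stab2 (by positivity) hA.proj
  have hneg : f (θ, γ) = -S fun i j => (A i j : ℝ) - lam Z θ γ i j := by
    rw [← map_neg]
    refine congr_arg S ?_
    funext i j
    simp
  have hstart : ‖f (θ, γ)‖ ≤ 1 / 2 * r := by
    have k1 := stab1 hA.row hA.col
    have hE6 : τ ≤ E ^ 6 * τ := le_mul_of_one_le_left hτ (one_le_pow₀ hE1)
    rw [hneg, norm_neg]
    refine max_le ?_ ?_
    · refine k1.trans ?_
      have m := mul_le_mul_of_nonneg_left (eκ 13 (by norm_num)) (by positivity : 0 ≤ p * q ^ 2)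
      calc _ ≤ 14 * E ^ 5 * (5 * E * τ + p * q * E * (κ * (24 * q * E ^ 7 * τ ^ 2))) := by gcongr
        _ = 70 * (E ^ 6 * τ) + 336 * (p * q ^ 2 * (κ * E ^ 13 * τ)) * τ := by ring
        _ ≤ 70 * (E ^ 6 * τ) + 1 * τ := by gcongr; linarith
        _ ≤ 1 / 2 * r := by rw [hr]; linarith
    · refine hnoise2.trans ?_
      have m := mul_le_mul_of_nonneg_left (eκ 7 (by norm_num)) hq.le
      calc _ = 24 * (q * (κ * E ^ 7 * τ)) * τ := by ring
        _ ≤ 1 * τ := by gcongr; linarith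
        _ ≤ 1 / 2 * r := by rw [hr]; linarith
  have happ : ApproximatesLinearOn f (ContinuousLinearMap.id ℝ (Param n p))
      (Metric.closedBall (θ, γ) r) (1 / 2) := by
    intro x hx y hy
    rw [mem_closedBall_iff_norm] at hx hy
    rw [ContinuousLinearMap.id_apply, hrem]
    simpa using hcontr x y hx hy
  let inv : (ContinuousLinearMap.id ℝ (Param n p)).NonlinearRightInverse :=
    { toFun := id, nnnorm := 1, bound' := by simp, right_inv' := by simp }
  obtain ⟨x, hx, hfx⟩ := happ.surjOn_closedBall_of_nonlinearRightInverse inv hr0 subset_rfl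
    (show (0 : Param n p) ∈ _ by
      rw [mem_closedBall_iff_norm, zero_sub, norm_neg]
      refine hstart.trans_eq ?_
      simp only [inv]
      norm_num)
  rw [mem_closedBall_iff_norm] at hx
  refine ⟨x, (isMLE_iff_scorePairing Z A x).2 ?_, by rwa [← hr], ?_⟩
  · rw [← hS]
    change scorePairing Z (lam Z θ γ * predictor Z (f x)) = 0
    rw [hfx, map_zero, mul_zero, map_zero]
  · -- `x - (θ, γ) = S (A - λ) - S (remainder)`
    have hself : x - (θ, γ) = (S fun i j => (A i j : ℝ) - lam Z θ γ i j) - S (rem x (θ, γ)) := by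
      rw [← hrem, hfx, hneg]
      abel
    have hc := hrem_le x (θ, γ) hx (by simpa using hr0)
    have k2 := stabc2 (by positivity) hc
    have hsnd : x.2 - γ = (S fun i j => (A i j : ℝ) - lam Z θ γ i j).2 - (S (rem x (θ, γ))).2 :=
      congr_arg Prod.snd hself
    rw [hsnd]
    refine (norm_sub_le _ _).trans ((add_le_add hnoise2 k2).trans ?_)
    have hE7 : E ^ 7 ≤ E ^ 19 := pow_le_pow_right₀ hE1 (by norm_num)
    calc _ ≤ κ * (24 * q * E ^ 19 * τ ^ 2)
          + κ * (8 * E ^ 6 * q * (2 * b ^ 2 * E * r * r)) := by gcongr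
      _ = (24 * q * 1 + 322624 * q * b ^ 2) * (κ * E ^ 19 * τ ^ 2) := by rw [hr]; ring
      _ ≤ (24 * q * b ^ 2 + 322624 * q * b ^ 2) * (κ * E ^ 19 * τ ^ 2) := by gcongr
      _ ≤ 400000 * q * b ^ 2 * (κ * E ^ 19 * τ ^ 2) := by
          have : 0 ≤ q * b ^ 2 * (κ * E ^ 19 * τ ^ 2) := by positivity
          linarith

end

/-! ### Deviation bounds for Poisson weights -/

theorem integrable_exp_mul_poisson (r : NNReal) (s : ℝ) :
    Integrable (fun k : ℕ => Real.exp (s * ((k : ℝ) - r))) (poissonMeasure r) := by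
  rw [integrable_poissonMeasure_iff]
  have h : Summable fun k : ℕ => Real.exp (-r) * Real.exp (-(s * r)) *
      ((r * Real.exp s) ^ k / (k.factorial : ℝ)) :=
    (Real.summable_pow_div_factorial (r * Real.exp s)).mul_left _
  refine h.congr fun k => ?_
  rw [Real.norm_eq_abs, abs_of_pos (Real.exp_pos _), mul_sub, sub_eq_add_neg, Real.exp_add,
    mul_comm s (k : ℝ), Real.exp_nat_mul, mul_pow]
  ring

/-- The moment generating function of a centred Poisson variable. -/
theorem integral_exp_mul_poisson (r : NNReal) (s : ℝ) :
    ∫ k : ℕ, Real.exp (s * ((k : ℝ) - r)) ∂(poissonMeasure r)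
      = Real.exp (r * (Real.exp s - 1 - s)) := by
  rw [integral_poissonMeasure]
  have hexp : ∀ x : ℝ, HasSum (fun k : ℕ => x ^ k / (k.factorial : ℝ)) (Real.exp x) := fun x => by
    rw [Real.exp_eq_exp_ℝ]
    exact NormedSpace.expSeries_div_hasSum_exp x
  have h := (hexp (r * Real.exp s)).mul_left (Real.exp (-r) * Real.exp (-(s * r)))
  rw [← Real.exp_add, ← Real.exp_add] at h
  convert! h.tsum_eq using 1
  · refine tsum_congr fun k => ?_
    rw [smul_eq_mul, mul_sub, sub_eq_add_neg (s * (k : ℝ)), Real.exp_add (s * (k : ℝ)),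
      mul_comm s (k : ℝ), Real.exp_nat_mul, mul_pow, Real.exp_add]
    ring
  · congr 1; ring

section
variable {n p : ℕ} {Ω : Type*} [MeasurableSpace Ω] {P : Measure Ω} [IsProbabilityMeasure P]
  {a : Fin n → Fin n → Ω → ℕ} {Z : Fin n → Fin n → Fin p → ℝ} {θ : DegIdx n → ℝ} {γ : Fin p → ℝ}

/-- Weighted sum of the centred edge weights. -/
noncomputable def noise (a : Fin n → Fin n → Ω → ℕ) (Z : Fin n → Fin n → Fin p → ℝ)
    (θ : DegIdx n → ℝ) (γ : Fin p → ℝ) (c : Edge n → ℝ) (ω : Ω) : ℝ :=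
  ∑ e : Edge n, c e * ((a e.1.1 e.1.2 ω : ℝ) - lam Z θ γ e.1.1 e.1.2)

/-- Chernoff bound for weighted sums of centred edge weights, with tilting parameter `s`. -/
theorem measureReal_le_noise (hmod : IsModel P a Z θ γ) {E : ℝ}
    (hlam : ∀ i j, i ≠ j → lam Z θ γ i j ≤ E) (c : Edge n → ℝ) {s B t : ℝ} (hs : 0 ≤ s)
    (hsc : ∀ e, s * |c e| ≤ 1) (hB : E * ∑ e, c e ^ 2 ≤ B) :
    P.real {ω | t ≤ noise a Z θ γ c ω} ≤ Real.exp (-s * t + s ^ 2 * B) := by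
  let X : Edge n → Ω → ℝ := fun e ω => c e * ((a e.1.1 e.1.2 ω : ℝ) - lam Z θ γ e.1.1 e.1.2)
  have hmeas : ∀ e, Measurable (X e) := fun e =>
    (measurable_from_nat.comp (hmod.measurable _ _ e.2)).sub_const _ |>.const_mul _
  have hind : iIndepFun X P :=
    hmod.indep.comp (fun e (k : ℕ) => c e * ((k : ℝ) - lam Z θ γ e.1.1 e.1.2))
      fun e => measurable_from_nat
  have hr : ∀ e : Edge n, ((lam Z θ γ e.1.1 e.1.2).toNNReal : ℝ) = lam Z θ γ e.1.1 e.1.2 :=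
    fun e => Real.coe_toNNReal _ (Real.exp_pos _).le
  have hfun : ∀ e, (fun ω => Real.exp (s * X e ω))
      = (fun k : ℕ => Real.exp (s * c e * ((k : ℝ) - (lam Z θ γ e.1.1 e.1.2).toNNReal)))
        ∘ a e.1.1 e.1.2 := by
    intro e
    funext ω
    simp only [X, Function.comp, hr, mul_assoc]
  have hint : ∀ e, Integrable (fun ω => Real.exp (s * X e ω)) P := by
    intro e
    rw [hfun e, ← integrable_map_measure .of_discrete (hmod.measurable _ _ e.2).aemeasurable,
      hmod.law _ _ e.2]
    exact integrable_exp_mul_poisson _ _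
  have hmgf : ∀ e, mgf (X e) P s ≤ Real.exp (s ^ 2 * (E * c e ^ 2)) := by
    intro e
    rw [mgf, hfun e]
    have := integral_map (hmod.measurable _ _ e.2).aemeasurable (μ := P)
      (f := fun k : ℕ => Real.exp (s * c e * ((k : ℝ) - (lam Z θ γ e.1.1 e.1.2).toNNReal)))
      .of_discrete
    rw [Function.comp_def, ← this, hmod.law _ _ e.2, integral_exp_mul_poisson, hr]
    refine Real.exp_le_exp.2 ?_
    -- `exp u - 1 - u ≤ u²` for `|u| ≤ 1`
    have h1 : |s * c e| ≤ 1 := by rw [abs_mul, abs_of_nonneg hs]; exact hsc e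
    have h2 := (le_abs_self _).trans (Real.abs_exp_sub_one_sub_id_le h1)
    have hl : 0 ≤ lam Z θ γ e.1.1 e.1.2 := (Real.exp_pos _).le
    calc _ ≤ lam Z θ γ e.1.1 e.1.2 * (s * c e) ^ 2 := mul_le_mul_of_nonneg_left h2 hl
      _ ≤ E * (s * c e) ^ 2 := mul_le_mul_of_nonneg_right (hlam _ _ e.2) (sq_nonneg _)
      _ = _ := by ring
  have hsum : noise a Z θ γ c = ∑ e, X e := by
    funext ω
    simp only [noise, X, Finset.sum_apply]
  rw [hsum]
  refine (measure_ge_le_exp_mul_mgf t hs (hind.integrable_exp_mul_sum hmeas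
    fun e _ => hint e)).trans ?_
  rw [hind.mgf_sum hmeas, Real.exp_add]
  refine mul_le_mul_of_nonneg_left ?_ (Real.exp_pos _).le
  refine (Finset.prod_le_prod (fun e _ => mgf_nonneg) fun e _ => hmgf e).trans ?_
  rw [← Real.exp_sum, ← Finset.mul_sum, ← Finset.mul_sum]
  exact Real.exp_le_exp.2 (mul_le_mul_of_nonneg_left hB (sq_nonneg s))

/-- Gaussian-type deviations at the level `√(log n)`. If the coefficients are bounded by `L`, then
`N` may be taken as the number of nonzero ones, but at least `n`: this keeps the tilting parameter
in the range where the Poisson moment generating function is sub-Gaussian. -/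
theorem measureReal_abs_noise_le (hmod : IsModel P a Z θ γ) {E : ℝ} (hE : 1 ≤ E)
    (hlam : ∀ i j, i ≠ j → lam Z θ γ i j ≤ E) (hn : 3 ≤ n) (c : Edge n → ℝ) {L N : ℝ}
    (hL : 0 < L) (hN : n ≤ N) (hc : ∀ e, |c e| ≤ L) (hc2 : ∑ e, c e ^ 2 ≤ N * L ^ 2) :
    P.real {ω | 3 * E * L * Real.sqrt (N * Real.log n) < |noise a Z θ γ c ω|}
      ≤ 2 / (n : ℝ) ^ 2 := by
  have hn0 : (0 : ℝ) < n := by positivity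
  have hn3 : (3 : ℝ) ≤ n := by exact_mod_cast hn
  have hN0 : 0 < N := hn0.trans_le hN
  have hE0 : 0 < E := one_pos.trans_le hE
  have hlog : 0 ≤ Real.log n := Real.log_nonneg (by linarith)
  have hlogN : Real.log n ≤ N := (Real.log_le_self hn0.le).trans hN
  -- the tilting parameter
  set s : ℝ := Real.sqrt (Real.log n / N) / (E * L) with hs
  have hs0 : 0 ≤ s := by positivity
  have hs2 : s ^ 2 = Real.log n / N / (E * L) ^ 2 := by
    rw [hs, div_pow, Real.sq_sqrt (by positivity)]
  have hst : s * (3 * E * L * Real.sqrt (N * Real.log n)) = 3 * Real.log n := by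
    have : Real.sqrt (Real.log n / N) * Real.sqrt (N * Real.log n) = Real.log n := by
      rw [← Real.sqrt_mul (by positivity), show Real.log n / N * (N * Real.log n)
        = Real.log n * Real.log n by field_simp, Real.sqrt_mul_self hlog]
    rw [hs, show Real.sqrt (Real.log n / N) / (E * L) * (3 * E * L * Real.sqrt (N * Real.log n))
      = 3 * (Real.sqrt (Real.log n / N) * Real.sqrt (N * Real.log n)) by field_simp, this]
  have hsc : ∀ e, s * |c e| ≤ 1 := by
    intro e
    have h1 : Real.sqrt (Real.log n / N) ≤ 1 :=
      Real.sqrt_le_one.2 ((div_le_one hN0).2 hlogN)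
    calc s * |c e| ≤ s * L := mul_le_mul_of_nonneg_left (hc e) hs0
      _ = Real.sqrt (Real.log n / N) / E := by rw [hs]; field_simp
      _ ≤ 1 := (div_le_one hE0).2 (h1.trans hE)
  have hexp : ∀ c : Edge n → ℝ, (∀ e, s * |c e| ≤ 1) → ∑ e, c e ^ 2 ≤ N * L ^ 2 →
      P.real {ω | 3 * E * L * Real.sqrt (N * Real.log n) ≤ noise a Z θ γ c ω}
        ≤ 1 / (n : ℝ) ^ 2 := by
    intro c hsc hc2
    refine (measureReal_le_noise hmod hlam c hs0 hsc
      (mul_le_mul_of_nonneg_left hc2 hE0.le)).trans ?_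
    have h1 : s ^ 2 * (E * (N * L ^ 2)) ≤ Real.log n := by
      rw [hs2, show Real.log n / N / (E * L) ^ 2 * (E * (N * L ^ 2)) = Real.log n / E by
        field_simp]
      exact div_le_self hlog hE
    have h2 : Real.exp (-2 * Real.log n) = 1 / (n : ℝ) ^ 2 := by
      rw [neg_mul, Real.exp_neg, two_mul, Real.exp_add, Real.exp_log hn0, one_div, pow_two]
    rw [← h2]
    refine Real.exp_le_exp.2 ?_
    linarith
  have hneg : ∀ ω, noise a Z θ γ (-c) ω = -noise a Z θ γ c ω := fun ω => by
    simp [noise]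
  calc _ ≤ P.real ({ω | 3 * E * L * Real.sqrt (N * Real.log n) ≤ noise a Z θ γ c ω} ∪
        {ω | 3 * E * L * Real.sqrt (N * Real.log n) ≤ noise a Z θ γ (-c) ω}) := by
        refine measureReal_mono fun ω hω => ?_
        simp only [Set.mem_ofPred_eq, Set.mem_union, hneg] at hω ⊢
        exact (lt_abs.1 hω).imp le_of_lt le_of_lt
    _ ≤ 1 / (n : ℝ) ^ 2 + 1 / (n : ℝ) ^ 2 :=
        (measureReal_union_le _ _).trans (add_le_add (hexp c hsc hc2)
          (hexp (-c) (by simpa using hsc) (by simpa using hc2)))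
    _ = _ := by ring

end

/-! ### Uniqueness of the MLE -/

/-- Strict monotonicity of `exp`: the score pairing of `λ(x) - λ(y)` with `x - y` has only
nonnegative terms, so if it vanishes, the two linear predictors agree. -/
theorem mle_unique {n p : ℕ} (Z : Fin n → Fin n → Fin p → ℝ)
    (hinj : ∀ x : Param n p, (∀ i j, i ≠ j → predictor Z x i j = 0) → x = 0)
    {A : Fin n → Fin n → ℕ} {x y : Param n p} (hx : IsMLE Z A x.1 x.2) (hy : IsMLE Z A y.1 y.2) :
    x = y := by
  rw [isMLE_iff_scorePairing] at hx hy
  refine sub_eq_zero.1 (hinj _ fun i j hij => ?_)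
  have h : ∑ e : Edge n, (lam Z x.1 x.2 e.1.1 e.1.2 - lam Z y.1 y.2 e.1.1 e.1.2)
      * predictor Z (x - y) e.1.1 e.1.2 = 0 := by
    have h1 := LinearMap.congr_fun (hx.trans hy.symm) (x - y)
    rw [scorePairing_apply, scorePairing_apply, ← sub_eq_zero, ← Finset.sum_sub_distrib] at h1
    rw [← h1]
    exact Finset.sum_congr rfl fun e _ => by ring
  have hd : ∀ i j, predictor Z (x - y) i j
      = linPred Z x.1 x.2 i j - linPred Z y.1 y.2 i j := fun i j => by
    rw [map_sub]; rfl
  have h0 : ∀ e : Edge n, 0 ≤ (lam Z x.1 x.2 e.1.1 e.1.2 - lam Z y.1 y.2 e.1.1 e.1.2)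
      * predictor Z (x - y) e.1.1 e.1.2 := by
    intro e
    rw [hd, lam, lam]
    rcases le_total (linPred Z x.1 x.2 e.1.1 e.1.2) (linPred Z y.1 y.2 e.1.1 e.1.2) with hle | hle
    · exact mul_nonneg_of_nonpos_of_nonpos (sub_nonpos.2 (Real.exp_le_exp.2 hle))
        (sub_nonpos.2 hle)
    · exact mul_nonneg (sub_nonneg.2 (Real.exp_le_exp.2 hle)) (sub_nonneg.2 hle)
  have h2 := (Finset.sum_eq_zero_iff_of_nonneg fun e _ => h0 e).1 h ⟨(i, j), hij⟩ (by simp)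
  rcases mul_eq_zero.1 h2 with h3 | h3
  · rw [hd, Real.exp_injective (sub_eq_zero.1 h3), sub_self]
  · exact h3

/-! ### Noise level of the data -/

section
variable {n p : ℕ} {Ω : Type*} {a : Fin n → Fin n → Ω → ℕ} {Z : Fin n → Fin n → Fin p → ℝ}
  {θ : DegIdx n → ℝ} {γ : Fin p → ℝ}

theorem noise_row (i : Fin n) (ω : Ω) :
    noise a Z θ γ (fun e => if e.1.1 = i then 1 else 0) ω
      = ∑ j with j ≠ i, ((a i j ω : ℝ) - lam Z θ γ i j) := by
  rw [noise, sum_edge fun i' j => (if i' = i then (1 : ℝ) else 0)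
    * ((a i' j ω : ℝ) - lam Z θ γ i' j)]
  rw [Finset.sum_eq_single i (fun b _ hb => by simp [hb]) (by simp)]
  simp

theorem noise_col (j : Fin n) (ω : Ω) :
    noise a Z θ γ (fun e => if e.1.2 = j then 1 else 0) ω
      = ∑ i with i ≠ j, ((a i j ω : ℝ) - lam Z θ γ i j) := by
  rw [noise, sum_edge' fun i j' => (if j' = j then (1 : ℝ) else 0)
    * ((a i j' ω : ℝ) - lam Z θ γ i j')]
  rw [Finset.sum_eq_single j (fun b _ hb => by simp [hb]) (by simp)]
  simp

end

section
variable {n p : ℕ} {Ω : Type*} [MeasurableSpace Ω] {P : Measure Ω} [IsProbabilityMeasure P]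
  {a : Fin n → Fin n → Ω → ℕ} {Z : Fin n → Fin n → Fin p → ℝ} {θ : DegIdx n → ℝ} {γ : Fin p → ℝ}
  {q E : ℝ}

theorem one_le_log {n : ℕ} (hn : 3 ≤ n) : 1 ≤ Real.log n := by
  rw [Real.le_log_iff_exp_le (by positivity)]
  have : (3 : ℝ) ≤ n := by exact_mod_cast hn
  linarith [Real.exp_one_lt_d9]

/-- With high probability, the noise is of the order required by `Bounds.exists_mle_near`. -/
theorem Bounds.measureReal_not_noiseBounds_le (h : Bounds Z θ γ q E) (hmod : IsModel P a Z θ γ)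
    {R : Fin p → Param n p}
    (hR : ∀ k i j, i ≠ j → |predictor Z (R k) i j| ≤ 8 * E ^ 6 * q) :
    P.real {ω | ¬ NoiseBounds Z (fun i j => a i j ω) θ γ R (5 * E * Real.sqrt (Real.log n / n))
        (24 * q * E ^ 7 * Real.sqrt (Real.log n / n) ^ 2)} ≤ (4 + 2 * p) / n := by
  have hE := h.E_pos
  have hq := h.q_pos
  have hn3 : (3 : ℝ) ≤ n := by exact_mod_cast h.three_le
  have hn0 : (0 : ℝ) < n := by linarith
  have hlog := one_le_log h.three_le
  have hlam : ∀ i j, i ≠ j → lam Z θ γ i j ≤ E := fun i j hij => (h.lam_bounds i j hij).2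
  set τ := Real.sqrt (Real.log n / n) with hτ
  have hτ0 : 0 ≤ τ := Real.sqrt_nonneg _
  have hτ2 : τ ^ 2 = Real.log n / n := Real.sq_sqrt (by positivity)
  have hnτ : Real.sqrt (n * Real.log n) = n * τ := by
    rw [Real.sqrt_eq_iff_mul_self_eq (by positivity) (by positivity)]
    have : n * τ * (n * τ) = n ^ 2 * τ ^ 2 := by ring
    rw [this, hτ2]
    field_simp
  have hn2 : Real.sqrt ((n : ℝ) ^ 2 * Real.log n) ≤ n ^ 2 * τ ^ 2 := by
    rw [hτ2, show (n : ℝ) ^ 2 * (Real.log n / n) = n * Real.log n by field_simp]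
    refine Real.sqrt_le_iff.2 ⟨by positivity, ?_⟩
    have : (n : ℝ) ^ 2 * Real.log n * 1 ≤ (n : ℝ) ^ 2 * Real.log n * Real.log n :=
      mul_le_mul_of_nonneg_left hlog (by positivity)
    linarith
  have hthr : 3 * E * 1 * Real.sqrt (n * Real.log n) ≤ (n - 1) * (5 * E * τ) := by
    rw [hnτ]
    have : 0 ≤ E * τ * (2 * n - 5) := mul_nonneg (by positivity) (by linarith)
    linarith
  -- the coefficients of the three kinds of linear statistics, and their deviation levels
  let c : Fin n ⊕ Fin n ⊕ Fin p → Edge n → ℝ := fun s => match s with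
    | Sum.inl i => fun e => if e.1.1 = i then 1 else 0
    | Sum.inr (Sum.inl j) => fun e => if e.1.2 = j then 1 else 0
    | Sum.inr (Sum.inr k) => fun e => predictor Z (R k) e.1.1 e.1.2
  let t : Fin n ⊕ Fin n ⊕ Fin p → ℝ := fun s => match s with
    | Sum.inl _ => 3 * E * 1 * Real.sqrt (n * Real.log n)
    | Sum.inr (Sum.inl _) => 3 * E * 1 * Real.sqrt (n * Real.log n)
    | Sum.inr (Sum.inr _) => 3 * E * (8 * E ^ 6 * q) * Real.sqrt ((n : ℝ) ^ 2 * Real.log n)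
  have hdev : ∀ s, P.real {ω | t s < |noise a Z θ γ (c s) ω|} ≤ 2 / (n : ℝ) ^ 2 := by
    rintro (i | j | k)
    · refine measureReal_abs_noise_le hmod h.one_le_E hlam h.three_le _ one_pos le_rfl
        (fun e => ?_) ?_
      · simp only [c]; split_ifs <;> simp
      · simp only [c, ite_pow, one_pow, zero_pow two_ne_zero, mul_one]
        rw [sum_edge fun i' _ => if i' = i then (1 : ℝ) else 0,
          Finset.sum_eq_single i (fun b _ hb => by simp [hb]) (by simp)]
        simp only [if_true, Finset.sum_const, nsmul_eq_mul, card_filter_ne]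
        linarith
    · refine measureReal_abs_noise_le hmod h.one_le_E hlam h.three_le _ one_pos le_rfl
        (fun e => ?_) ?_
      · simp only [c]; split_ifs <;> simp
      · simp only [c, ite_pow, one_pow, zero_pow two_ne_zero, mul_one]
        rw [sum_edge' fun _ j' => if j' = j then (1 : ℝ) else 0,
          Finset.sum_eq_single j (fun b _ hb => by simp [hb]) (by simp)]
        simp only [if_true, Finset.sum_const, nsmul_eq_mul, card_filter_ne]
        linarith
    · refine measureReal_abs_noise_le hmod h.one_le_E hlam h.three_le _ (by positivity)
        (by nlinarith) (fun e => hR k _ _ e.2) (sum_edge_le (by positivity) fun e => ?_)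
      exact sq_le_sq.2 (by
        rw [abs_of_pos (by positivity : 0 < 8 * E ^ 6 * q)]; exact hR k _ _ e.2)
  have hsub : {ω | ¬ NoiseBounds Z (fun i j => a i j ω) θ γ R (5 * E * τ)
      (24 * q * E ^ 7 * τ ^ 2)} ⊆ ⋃ s, {ω | t s < |noise a Z θ γ (c s) ω|} := by
    intro ω hω
    by_contra hcon
    simp only [Set.mem_iUnion, Set.mem_ofPred_eq, not_exists, not_lt] at hcon
    refine hω ⟨fun i => ?_, fun j => ?_, fun k => ?_⟩
    · rw [← noise_row]
      exact (hcon (Sum.inl i)).trans hthr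
    · rw [← noise_col]
      exact (hcon (Sum.inr (Sum.inl j))).trans hthr
    · have h1 := hcon (Sum.inr (Sum.inr k))
      have h2 : scorePairing Z (fun i j => (a i j ω : ℝ) - lam Z θ γ i j) (R k)
          = noise a Z θ γ (c (Sum.inr (Sum.inr k))) ω := by
        rw [scorePairing_apply, noise]
        exact Finset.sum_congr rfl fun e _ => mul_comm _ _
      rw [h2]
      refine h1.trans ?_
      calc _ ≤ 3 * E * (8 * E ^ 6 * q) * ((n : ℝ) ^ 2 * τ ^ 2) :=
            mul_le_mul_of_nonneg_left hn2 (by positivity)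
        _ = _ := by ring
  refine (measureReal_mono hsub).trans ((measureReal_iUnion_fintype_le _).trans ?_)
  refine (Finset.sum_le_sum fun s _ => hdev s).trans ?_
  simp only [Finset.sum_const, Finset.card_univ, Fintype.card_sum, Fintype.card_fin, nsmul_eq_mul]
  push_cast
  have hp0 : (0 : ℝ) ≤ p := Nat.cast_nonneg p
  rw [mul_div_assoc', div_le_div_iff₀ (by positivity) hn0]
  nlinarith [mul_nonneg hp0 (mul_nonneg hn0.le (by linarith : (0 : ℝ) ≤ n - 1))]

/-- For a fixed number of nodes, an MLE exists close to the true parameter with high probability. -/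
theorem Bounds.measureReal_not_mle_near_le (h : Bounds Z θ γ q E) (hsq : 2 * E ^ 2 ≤ n - 1)
    (hp : 0 < p) (hmod : IsModel P a Z θ γ) (hH : (H Z θ γ).PosDef) {κ δ : ℝ}
    (hκ : matNorm (H Z θ γ)⁻¹ ≤ κ / (n : ℝ) ^ 2)
    (hδ : 100000 * ((1 + p) * q ^ 2 * (2 + p * q) ^ 2) * δ ≤ 1)
    (h1 : κ * E ^ 20 * Real.sqrt (Real.log n / n) ≤ δ)
    (h2 : E ^ 19 * Real.sqrt (Real.log n / n) ≤ δ) :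
    P.real {ω | ¬ ∃ x : Param n p, IsMLE Z (fun i j => a i j ω) x.1 x.2 ∧
      ‖x - (θ, γ)‖ ≤ 142 * E ^ 6 * Real.sqrt (Real.log n / n) ∧
      ‖x.2 - γ‖ ≤ 400000 * q * (2 + p * q) ^ 2
        * (κ * E ^ 19 * Real.sqrt (Real.log n / n) ^ 2)} ≤ (4 + 2 * p) / n := by
  obtain ⟨R, hR, hRH⟩ := h.exists_efficient_basis hsq hH
  refine le_trans (measureReal_mono ?_) (h.measureReal_not_noiseBounds_le hmod hR)
  refine fun ω hω hA => hω ?_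
  exact h.exists_mle_near hsq hp hH hκ hR hRH (Real.sqrt_nonneg _) hA hδ h1 h2

end

/-! ### The intensities at the true parameter -/

theorem rho_nonneg_and_abs_linPred_le {n p : ℕ} (Z : Fin n → Fin n → Fin p → ℝ)
    (θ : DegIdx n → ℝ) (γ : Fin p → ℝ) {ε₁ ε₂ : ℝ} (h₁ : 0 ≤ ε₁) (h₂ : 0 ≤ ε₂) :
    0 ≤ rho Z θ γ ε₁ ε₂ ∧ ∀ i j, i ≠ j → |linPred Z θ γ i j| ≤ rho Z θ γ ε₁ ε₂ := by
  have hq : 0 ≤ covBound Z := Real.iSup_nonneg fun e => norm_nonneg _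
  have hs : 0 ≤ ⨆ e : Edge n, |alpha θ e.1.1 + beta θ e.1.2| :=
    Real.iSup_nonneg fun e => abs_nonneg _
  have hg : 0 ≤ p * covBound Z * ‖γ‖ := by positivity
  have he : 0 ≤ p * covBound Z * ε₂ := by positivity
  refine ⟨by unfold rho; linarith, fun i j hij => ?_⟩
  have h1 : |alpha θ i + beta θ j| ≤ ⨆ e : Edge n, |alpha θ e.1.1 + beta θ e.1.2| :=
    le_ciSup (f := fun e : Edge n => |alpha θ e.1.1 + beta θ e.1.2|)
      (Set.finite_range _).bddAbove ⟨(i, j), hij⟩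
  have h2 : ‖Z i j‖ ≤ covBound Z :=
    le_ciSup (f := fun e : Edge n => ‖Z e.1.1 e.1.2‖) (Set.finite_range _).bddAbove ⟨(i, j), hij⟩
  have h3 : |∑ k, Z i j k * γ k| ≤ p * covBound Z * ‖γ‖ := by
    refine (Finset.abs_sum_le_sum_abs _ _).trans ?_
    refine (Finset.sum_le_card_nsmul _ _ (covBound Z * ‖γ‖) fun k _ => ?_).trans ?_
    · rw [abs_mul]
      exact mul_le_mul ((norm_le_pi_norm (Z i j) k).trans h2) (norm_le_pi_norm γ k)
        (abs_nonneg _) hq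
    · simp [mul_assoc]
  refine (abs_add_le _ _).trans ?_
  unfold rho
  linarith

theorem bounds_exp_rho {n p : ℕ} {Z : Fin n → Fin n → Fin p → ℝ} {θ : DegIdx n → ℝ}
    {γ : Fin p → ℝ} {ε₁ ε₂ q : ℝ} (hn : 3 ≤ n) (h₁ : 0 ≤ ε₁) (h₂ : 0 ≤ ε₂) (hq : 1 ≤ q)
    (hZ : ∀ i j, i ≠ j → ∀ k, |Z i j k| ≤ q) :
    Bounds Z θ γ q (Real.exp (rho Z θ γ ε₁ ε₂)) := by
  obtain ⟨h0, hl⟩ := rho_nonneg_and_abs_linPred_le Z θ γ h₁ h₂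
  refine ⟨hn, hq, Real.one_le_exp h0, hZ, fun i j hij => ⟨?_, ?_⟩⟩
  · rw [← Real.exp_neg]
    exact Real.exp_le_exp.2 (abs_le.1 (hl i j hij)).1
  · exact Real.exp_le_exp.2 (abs_le.1 (hl i j hij)).2

end PoissonNetwork

/-! ### Asymptotics -/

theorem theorem1
    {p : ℕ} (hp : 0 < p)
    {Ω : ℕ → Type*} [∀ n, MeasurableSpace (Ω n)]
    (P : ∀ n, Measure (Ω n)) [∀ n, IsProbabilityMeasure (P n)]
    (a : ∀ n, Fin n → Fin n → Ω n → ℕ)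
    (Z : ∀ n, Fin n → Fin n → Fin p → ℝ)
    (θs : ∀ n, DegIdx n → ℝ) (γs : ℕ → Fin p → ℝ)
    (ε₁ ε₂ κ : ℕ → ℝ)
    (N₀ : ℕ) (hN₀ : 3 ≤ N₀)
    (hmodel : ∀ n ≥ N₀, IsModel (P n) (a n) (Z n) (θs n) (γs n))
    (K : Set ℝ) (hK : IsCompact K)
    (hZ : ∀ n ≥ N₀, ∀ i j : Fin n, i ≠ j → ∀ k, Z n i j k ∈ K)
    (hε₁ : ∀ n ≥ N₀, 0 < ε₁ n) (hε₂ : ∀ n ≥ N₀, 0 < ε₂ n)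
    (hpos : ∀ n ≥ N₀, ∀ θ ∈ Metric.closedBall (θs n) (ε₁ n), (H (Z n) θ (γs n)).PosDef)
    (hκ : ∀ n ≥ N₀, ∀ θ ∈ Metric.closedBall (θs n) (ε₁ n),
      matNorm (H (Z n) θ (γs n))⁻¹ ≤ κ n / (n : ℝ) ^ 2)
    (hrate : (fun n => κ n ^ 2 *
        Real.exp (40 * rho (Z n) (θs n) (γs n) (ε₁ n) (ε₂ n)))
      =o[atTop] fun n : ℕ => (n : ℝ) / Real.log n) :
    (∃ C : ℝ, ∀ n ≥ N₀,
      1 - C / n ≤ (P n).real {ω | ∃ θ γ, IsMLE (Z n) (fun i j => a n i j ω) θ γ}) ∧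
    (∀ n ≥ N₀, ∀ (A : Fin n → Fin n → ℕ) (θ θ' : DegIdx n → ℝ) (γ γ' : Fin p → ℝ),
      IsMLE (Z n) A θ γ → IsMLE (Z n) A θ' γ' → θ = θ' ∧ γ = γ') ∧
    (∀ (θhat : ∀ n, Ω n → DegIdx n → ℝ) (γhat : ∀ n, Ω n → Fin p → ℝ),
      (∀ n ≥ N₀, ∀ ω, (∃ θ γ, IsMLE (Z n) (fun i j => a n i j ω) θ γ) →
        IsMLE (Z n) (fun i j => a n i j ω) (θhat n ω) (γhat n ω)) →
      IsBigOp P (fun n ω => ‖γhat n ω - γs n‖)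
        (fun n => κ n * Real.exp (21 * rho (Z n) (θs n) (γs n) (ε₁ n) (ε₂ n)) *
          Real.log n / n) ∧
      IsLittleOpOne P (fun n ω => ‖γhat n ω - γs n‖) ∧
      IsBigOp P (fun n ω => ‖θhat n ω - θs n‖)
        (fun n => Real.exp (7 * rho (Z n) (θs n) (γs n) (ε₁ n) (ε₂ n)) *
          Real.sqrt (Real.log n / n)) ∧
      IsLittleOpOne P (fun n ω => ‖θhat n ω - θs n‖)) := by
  obtain ⟨q₀, hq₀⟩ := hK.isBounded.exists_norm_le
  obtain ⟨q, hq⟩ : ∃ q, q = max 1 q₀ := ⟨_, rfl⟩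
  have hq1 : 1 ≤ q := hq ▸ le_max_left _ _
  obtain ⟨E, hE⟩ : ∃ E : ℕ → ℝ, E = fun n =>
    Real.exp (rho (Z n) (θs n) (γs n) (ε₁ n) (ε₂ n)) := ⟨_, rfl⟩
  obtain ⟨τ, hτ⟩ : ∃ τ : ℕ → ℝ, τ = fun n : ℕ => Real.sqrt (Real.log n / n) := ⟨_, rfl⟩
  have hexp : ∀ (k : ℕ) n, Real.exp (k * rho (Z n) (θs n) (γs n) (ε₁ n) (ε₂ n)) = E n ^ k :=
    fun k n => by rw [Real.exp_nat_mul, hE]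
  have hB : ∀ n ≥ N₀, Bounds (Z n) (θs n) (γs n) q (E n) := fun n hn => by
    rw [hE]
    exact bounds_exp_rho (hN₀.trans hn) (hε₁ n hn).le (hε₂ n hn).le hq1 fun i j hij k =>
      (hq₀ _ (hZ n hn i j hij k)).trans (hq ▸ le_max_right _ _)
  have hH : ∀ n ≥ N₀, (H (Z n) (θs n) (γs n)).PosDef := fun n hn =>
    hpos n hn _ (Metric.mem_closedBall_self (hε₁ n hn).le)
  have hκ' : ∀ n ≥ N₀, matNorm (H (Z n) (θs n) (γs n))⁻¹ ≤ κ n / (n : ℝ) ^ 2 := fun n hn =>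
    hκ n hn _ (Metric.mem_closedBall_self (hε₁ n hn).le)
  have hτ0 : ∀ n, 0 ≤ τ n := fun n => hτ ▸ Real.sqrt_nonneg _
  have hτ2 : ∀ n, τ n ^ 2 = Real.log n / n := fun n => by
    rw [hτ]; exact Real.sq_sqrt (div_nonneg (Real.log_natCast_nonneg n) (Nat.cast_nonneg n))
  have hκ1 : ∀ n ≥ N₀, 1 ≤ κ n * (E n * q ^ 2) := fun n hn =>
    (hB n hn).one_le_kappa hp (hH n hn) (hκ' n hn)
  have hE0 : ∀ n ≥ N₀, 0 < E n := fun n hn => (hB n hn).E_pos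
  have hκ0 : ∀ n ≥ N₀, 0 < κ n := fun n hn =>
    pos_of_mul_pos_left (one_pos.trans_le (hκ1 n hn))
      (mul_nonneg (hE0 n hn).le (sq_nonneg q))
  have hE19 : ∀ n ≥ N₀, E n ^ 19 * τ n ≤ q ^ 2 * (κ n * E n ^ 20 * τ n) := by
    intro n hn
    have := mul_le_mul_of_nonneg_left (hκ1 n hn)
      (mul_nonneg (pow_nonneg (hE0 n hn).le 19) (hτ0 n))
    calc _ = E n ^ 19 * τ n * 1 := by ring
      _ ≤ _ := this
      _ = _ := by ring
  -- the rate condition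
  have hsmall : ∀ δ > 0, ∀ᶠ n in atTop, κ n * E n ^ 20 * τ n ≤ δ := by
    intro δ hδ
    filter_upwards [hrate.def (sq_pos_of_pos hδ), eventually_ge_atTop N₀] with n hn hnN
    have hn3 : 3 ≤ n := hN₀.trans hnN
    have hlog : 0 < Real.log n := one_pos.trans_le (one_le_log hn3)
    have hn0 : (0 : ℝ) < n := by positivity
    rw [show (40 : ℝ) = (40 : ℕ) by norm_num, hexp, Real.norm_of_nonneg
      (mul_nonneg (sq_nonneg _) (pow_nonneg (hE0 n hnN).le _)),
      Real.norm_of_nonneg (by positivity)] at hn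
    refine le_of_sq_le_sq ?_ hδ.le
    calc (κ n * E n ^ 20 * τ n) ^ 2 = κ n ^ 2 * E n ^ 40 * τ n ^ 2 := by ring
      _ ≤ δ ^ 2 * (n / Real.log n) * τ n ^ 2 := mul_le_mul_of_nonneg_right hn (sq_nonneg _)
      _ = δ ^ 2 := by rw [hτ2]; field_simp
  have huniq : ∀ n ≥ N₀, ∀ (A : Fin n → Fin n → ℕ) (x y : Param n p),
      IsMLE (Z n) A x.1 x.2 → IsMLE (Z n) A y.1 y.2 → x = y := fun n hn A x y hx hy =>
    mle_unique (Z n) (fun x => predictor_injective (Z n) (hN₀.trans hn) (hH n hn)) hx hy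
  obtain ⟨M, hM⟩ : ∃ M : ℝ, M = (1 + p) * q ^ 2 * (2 + p * q) ^ 2 := ⟨_, rfl⟩
  obtain ⟨C, hC⟩ : ∃ C : ℝ, C = 400000 * q * (2 + p * q) ^ 2 := ⟨_, rfl⟩
  have hM1 : 1 ≤ M := by
    have hp0 : (0 : ℝ) ≤ p := Nat.cast_nonneg p
    have h1 : 1 ≤ q ^ 2 := one_le_pow₀ hq1
    have h2 : (1 : ℝ) ≤ (2 + p * q) ^ 2 := one_le_pow₀ (by nlinarith)
    rw [hM]
    exact one_le_mul_of_one_le_of_one_le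
      (one_le_mul_of_one_le_of_one_le (by linarith) h1) h2
  -- the exceptional events
  let bad : ∀ n, Set (Ω n) := fun n => {ω | ¬ ∃ x : Param n p,
    IsMLE (Z n) (fun i j => a n i j ω) x.1 x.2 ∧ ‖x - (θs n, γs n)‖ ≤ 142 * E n ^ 6 * τ n ∧
      ‖x.2 - γs n‖ ≤ C * (κ n * E n ^ 19 * τ n ^ 2)}
  have hbad : ∀ᶠ n in atTop, (P n).real (bad n) ≤ (4 + 2 * p) / n := by
    have hq2 : 0 < q ^ 2 := by positivity
    filter_upwards [hsmall (1 / (100000 * M) / q ^ 2) (by positivity),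
      eventually_ge_atTop N₀] with n hn hnN
    have hn3 : (3 : ℝ) ≤ n := by exact_mod_cast hN₀.trans hnN
    have h2 : E n ^ 19 * τ n ≤ 1 / (100000 * M) := by
      refine (hE19 n hnN).trans ((mul_le_mul_of_nonneg_left hn hq2.le).trans_eq ?_)
      field_simp
    have h1 : κ n * E n ^ 20 * τ n ≤ 1 / (100000 * M) :=
      hn.trans (div_le_self (by positivity) (one_le_pow₀ hq1))
    have hsq : 2 * E n ^ 2 ≤ n - 1 := by
      have hE2 : E n ^ 2 ≤ E n ^ 38 := pow_le_pow_right₀ (hB n hnN).one_le_E (by norm_num)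
      have h3 : E n ^ 19 * τ n ≤ 1 / 2 := h2.trans (by
        rw [div_le_div_iff₀ (by positivity) two_pos]; linarith)
      have h4 : (E n ^ 19 * τ n) ^ 2 ≤ (1 / 2) ^ 2 :=
        pow_le_pow_left₀ (mul_nonneg (pow_nonneg (hE0 n hnN).le _) (hτ0 n)) h3 2
      rw [mul_pow, hτ2, ← pow_mul, mul_div_assoc', div_le_iff₀ (by linarith)] at h4
      have h5 : E n ^ 38 * 1 ≤ E n ^ 38 * Real.log n :=
        mul_le_mul_of_nonneg_left (one_le_log (hN₀.trans hnN)) (pow_nonneg (hE0 n hnN).le _)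
      norm_num at h4
      linarith
    have := (hB n hnN).measureReal_not_mle_near_le hsq hp (hmodel n hnN) (hH n hnN) (hκ' n hnN)
      (δ := 1 / (100000 * M)) (by rw [← hM]; exact (mul_one_div_cancel (by positivity)).le)
      (by rw [hτ] at h1; exact h1) (by rw [hτ] at h2; exact h2)
    simpa only [bad, hτ, hC] using this
  have hlim : Tendsto (fun n : ℕ => (4 + 2 * p : ℝ) / n) atTop (nhds 0) :=
    tendsto_const_div_atTop_nhds_zero_nat _
  refine ⟨?_, fun n hn A θ θ' γ γ' h h' => ?_, fun θhat γhat hhat => ?_⟩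
  · obtain ⟨N₁, hN₁⟩ := eventually_atTop.1 hbad
    refine ⟨max (4 + 2 * (p : ℝ)) (N₁ : ℝ), fun n hn => ?_⟩
    have hn0 : (0 : ℝ) < n := by
      have : 3 ≤ n := hN₀.trans hn
      positivity
    rcases le_total N₁ n with h | h
    · have h1 : (P n).real (bad n)ᶜ ≤ (P n).real
          {ω | ∃ θ γ, IsMLE (Z n) (fun i j => a n i j ω) θ γ} := by
        refine measureReal_mono fun ω hω => ?_
        obtain ⟨x, hx, -⟩ := not_not.1 hω
        exact ⟨x.1, x.2, hx⟩
      have h2 : (1 : ℝ) ≤ (P n).real (bad n) + (P n).real (bad n)ᶜ := by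
        have := measureReal_union_le (μ := P n) (bad n) (bad n)ᶜ
        rwa [Set.union_compl_self, probReal_univ] at this
      have h3 : (4 + 2 * p : ℝ) / n ≤ max (4 + 2 * (p : ℝ)) (N₁ : ℝ) / n :=
        div_le_div_of_nonneg_right (le_max_left _ _) hn0.le
      have := hN₁ n h
      linarith
    · -- for small `n` the bound is trivial
      have h1 : (1 : ℝ) ≤ max (4 + 2 * (p : ℝ)) (N₁ : ℝ) / n := by
        rw [le_div_iff₀ hn0, one_mul]
        exact (Nat.cast_le.2 h).trans (le_max_right _ _)
      have : 0 ≤ (P n).real {ω | ∃ θ γ, IsMLE (Z n) (fun i j => a n i j ω) θ γ} :=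
        measureReal_nonneg
      linarith
  · exact Prod.ext_iff.1 (huniq n hn A (θ, γ) (θ', γ') h h')
  · have hgood : ∀ n ≥ N₀, ∀ ω ∉ bad n, ‖θhat n ω - θs n‖ ≤ 142 * E n ^ 6 * τ n ∧
        ‖γhat n ω - γs n‖ ≤ 142 * E n ^ 6 * τ n ∧
        ‖γhat n ω - γs n‖ ≤ C * (κ n * E n ^ 19 * τ n ^ 2) := by
      intro n hn ω hω
      obtain ⟨x, hx, hx1, hx2⟩ := not_not.1 hω
      have := huniq n hn _ x (θhat n ω, γhat n ω) hx (hhat n hn ω ⟨x.1, x.2, hx⟩)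
      subst this
      exact ⟨(norm_fst_le _).trans hx1, (norm_snd_le _).trans hx1, hx2⟩
    -- deterministic bounds outside of the exceptional events give bounds in probability
    have big : ∀ (X : ∀ n, Ω n → ℝ) (r : ℕ → ℝ) (M : ℝ),
        (∀ n ≥ N₀, ∀ ω ∉ bad n, |X n ω| ≤ M * r n) → IsBigOp P X r := by
      intro X r M hX ε hε
      refine ⟨M, ?_⟩
      filter_upwards [hbad, hlim.eventually_le_const hε, eventually_ge_atTop N₀]
        with n h1 h2 hn
      refine le_trans (measureReal_mono fun ω hω => ?_) (h1.trans h2)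
      by_contra hω'
      exact absurd (hX n hn ω hω') (not_le.2 hω)
    have little : ∀ X : ∀ n, Ω n → ℝ,
        (∀ n ≥ N₀, ∀ ω ∉ bad n, |X n ω| ≤ 142 * E n ^ 6 * τ n) → IsLittleOpOne P X := by
      intro X hX δ hδ
      refine squeeze_zero' (Eventually.of_forall fun n => measureReal_nonneg) ?_ hlim
      filter_upwards [hbad, hsmall (δ / 142 / q ^ 2) (by positivity), eventually_ge_atTop N₀]
        with n h1 h2 hn
      refine le_trans (measureReal_mono fun ω hω => ?_) h1
      by_contra hω'
      refine absurd ((hX n hn ω hω').trans ?_) (not_le.2 hω)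
      have h3 : E n ^ 6 * τ n ≤ E n ^ 19 * τ n := mul_le_mul_of_nonneg_right
        (pow_le_pow_right₀ (hB n hn).one_le_E (by norm_num)) (hτ0 n)
      have h4 := mul_le_mul_of_nonneg_left h2 (sq_nonneg q)
      have h5 : q ^ 2 * (δ / 142 / q ^ 2) = δ / 142 := by field_simp
      linarith [hE19 n hn]
    have hC0 : 0 ≤ C := by rw [hC]; positivity
    refine ⟨big _ _ C fun n hn ω hω => ?_, little _ fun n hn ω hω => ?_,
      big _ _ 142 fun n hn ω hω => ?_, little _ fun n hn ω hω => ?_⟩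
    · rw [abs_norm]
      refine (hgood n hn ω hω).2.2.trans (mul_le_mul_of_nonneg_left ?_ hC0)
      rw [show (21 : ℝ) = (21 : ℕ) by norm_num, hexp, hτ2, mul_div_assoc]
      exact mul_le_mul_of_nonneg_right (mul_le_mul_of_nonneg_left
        (pow_le_pow_right₀ (hB n hn).one_le_E (by norm_num)) (hκ0 n hn).le)
        (by rw [← hτ2]; exact sq_nonneg _)
    · rw [abs_norm]
      exact (hgood n hn ω hω).2.1
    · rw [abs_norm]
      refine (hgood n hn ω hω).1.trans ?_
      rw [show (7 : ℝ) = (7 : ℕ) by norm_num, hexp, mul_assoc, ← congr_fun hτ n]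
      exact mul_le_mul_of_nonneg_left (mul_le_mul_of_nonneg_right
        (pow_le_pow_right₀ (hB n hn).one_le_E (by norm_num)) (hτ0 n)) (by norm_num)
    · rw [abs_norm]
      exact (hgood n hn ω hω).1
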